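/- Let $S\subset\mathbb{C}^2$ be a finite set of points, not all on one complex line, and suppose that $S$ is contained in the union of $m$ distinct complex lines which all pass through a common point $P\in\mathbb{C}^2$. If one of these $m$ lines contains more than $m-2$ points of $S\setminus\{P\}$, then $S$ has an ordinary line, that is, there is a complex line passing through exactly two points of $S$. The bound $m-2$ is sharp, as the Fermat configurations show. For $n\ge 3$ let $$F_n=\bigl\{[1:-\omega:0],\ [0:1:-\omega],\ [-\omega:0:1]\ :\ \omega\in\mathbb{C},\ \omega^n=1\bigr\}\subset\mathbb{P}^2(\mathbb{C}).$$ Identify $\mathbb{C}^2$ with a subset of $\mathbb{P}^2(\mathbb{C})$ by $(x,y)\mapsto[x:y:1]$. For every $n\ge 3$ some projective automorphism maps $F_n$ onto a set $S\subset\mathbb{C}^2$ of $3n$ points, not all on one line, which has no ordinary line and is contained in the union of $m=n+2$ distinct lines through a common point $P\in\mathbb{C}^2\setminus S$, such that two of these lines contain exactly $n=m-2$ points of $S$ each and each of the other $n$ lines contains exactly one point of $S$. -/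

import Mathlib

open scoped LinearAlgebra.Projectivization

namespace SylvesterGallai

/-- A (complex, affine) line of `ℂ²`: a nonempty affine subspace of dimension one. -/
def IsLine (l : AffineSubspace ℂ (ℂ × ℂ)) : Prop :=
  (l : Set (ℂ × ℂ)).Nonempty ∧ Module.finrank ℂ l.direction = 1

/-- A line is ordinary for `S` if it passes through exactly two points of `S`. -/
def IsOrdinaryLine (S : Set (ℂ × ℂ)) (l : AffineSubspace ℂ (ℂ × ℂ)) : Prop :=
  IsLine l ∧ (S ∩ (l : Set (ℂ × ℂ))).ncard = 2

/-- `L` is a finite family of (distinct) lines, all of which pass through the point `P`. -/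
def IsConcurrentAt (L : Finset (AffineSubspace ℂ (ℂ × ℂ))) (P : ℂ × ℂ) : Prop :=
  ∀ l ∈ L, IsLine l ∧ P ∈ l

/-- Every point of `S` lies on some line of the family `L`. -/
def LiesOn (S : Set (ℂ × ℂ)) (L : Finset (AffineSubspace ℂ (ℂ × ℂ))) : Prop :=
  ∀ p ∈ S, ∃ l ∈ L, p ∈ l

/-- The number of points of `S` on the line `l`, not counting the point `P`. -/
noncomputable def countOff (S : Set (ℂ × ℂ)) (P : ℂ × ℂ)
    (l : AffineSubspace ℂ (ℂ × ℂ)) : ℕ :=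
  ((S ∩ (l : Set (ℂ × ℂ))) \ {P}).ncard

/-- The complex projective plane. -/
abbrev ProjPlane : Type := ℙ ℂ (Fin 3 → ℂ)

/-- The standard embedding `(x, y) ↦ [x : y : 1]` of `ℂ²` into the projective plane. -/
noncomputable def toProj (p : ℂ × ℂ) : ProjPlane :=
  Projectivization.mk ℂ ![p.1, p.2, 1] (fun h => one_ne_zero (congrFun h 2))

/-- The Fermat configuration: the points `[1 : -ω : 0]`, `[0 : 1 : -ω]`, `[-ω : 0 : 1]`, where `ω`
runs over the `n`-th roots of unity. -/
def fermatConfiguration (n : ℕ) : Set ProjPlane :=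
  {p | ∃ ω : ℂ, ω ^ n = 1 ∧
    (p = Projectivization.mk ℂ ![1, -ω, 0] (fun h => one_ne_zero (congrFun h 0)) ∨
      p = Projectivization.mk ℂ ![0, 1, -ω] (fun h => one_ne_zero (congrFun h 1)) ∨
      p = Projectivization.mk ℂ ![-ω, 0, 1] (fun h => one_ne_zero (congrFun h 2)))}

/-- `S ⊆ ℂ²` is a copy of the Fermat configuration: some projective automorphism of the projective
plane carries the Fermat configuration onto `S`. -/
def IsFermatConfiguration (n : ℕ) (S : Set (ℂ × ℂ)) : Prop :=
  ∃ g : (Fin 3 → ℂ) ≃ₗ[ℂ] (Fin 3 → ℂ),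
    Projectivization.map g.toLinearMap g.injective '' fermatConfiguration n = toProj '' S

end SylvesterGallai

/-!
Suppose that `S` has no ordinary line, and that the distinguished line contains at least `m - 1`
points other than `P`. A projective map sends this line to infinity, so that the remaining lines
become `n ≤ m - 1` vertical lines ("columns") `x = a i`, and the points on the distinguished line
become at least `n` slopes `s j`. Every line with one of these slopes through one of the remaining
points contains another one, in a different column (`exists_isOrdinaryLine` reduces to
`false_of_card_columns_le_card_slopes`).

Fix a generic real direction in the `y`-coordinate. For each slope take the highest line of this
slope meeting the set. By the collinearity property and genericity, it passes through the highest
points of at least two columns. Columns and slopes therefore form a bipartite graph with at least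
as many edges as vertices, and it contains a chordless cycle
(`exists_chordless_bipartite_cycle`). A cycle of length four would consist of two different lines
with two common points. A longer one is an `IsTightPolygon`: the lines `y = s t * x + b t` of the
cycle define a concave function `u = min_t Re (s t * x + b t)` on the `x`-plane, whose linear pieces
live on convex cells. The polygon with vertices `a t` runs through each cell exactly once, along
the edge from `a (t - 1)` to `a t`, and `∑ t, s t * (a t - a (t - 1)) = 0` because the `y`-values
return to their starting point. The imaginary part of this sum is the flux of the gradient of `u`
through the polygon. As the polygon is a simple closed curve and `u` is superharmonic and not linear
inside of it, the flux cannot vanish (`IsTightPolygon.false`).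

The last argument is carried out as follows. The winding number of the polygon is constant on each
side of the edge in each cell, and consecutive cells share points on either side, so that the winding
number takes the value `0` and one of the values `±1` only (`IsTightPolygon.exists_sign_windAngle`);
this replaces the Jordan curve theorem. The flux is not integrated over the interior: after
a rotation of the coordinates, its vanishing says that `∑ t, Im (s t) * Re (a t - a (t - 1))`
vanishes, and this sum is an integral over vertical lines. On a vertical line `u` is
concave, so that `Im (s t)` increases from each crossing with the polygon to the next one, and
summation by parts against the winding number shows that every vertical line contributes with the
same sign (`IsTightPolygon.sum_crossingSign_mul_im_neg`).

For sharpness, the Fermat configuration is moved into the affine plane together with a vertex of the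
triangle on whose sides it lies; points on the three sides are collinear if the product of
their parameters is one, whence no line is ordinary.
-/

/-! ### Chordless cycles in bipartite graphs -/

/-- A finite symmetric irreflexive relation in which one can always walk on without turning back
contains a chordless cycle: a closed non-backtracking walk of minimal length. -/
theorem exists_chordless_cycle {V : Type*} [Finite V] (Adj : V → V → Prop)
    (hsymm : ∀ u v, Adj u v → Adj v u) (hirr : ∀ v, ¬ Adj v v) (v₀ : V)
    (hnext : ∀ u v, Adj u v → ∃ w, Adj v w ∧ w ≠ u) (hv₀ : ∃ w, Adj v₀ w) :
    ∃ (L : ℕ) (_ : NeZero L) (c : ZMod L → V), 3 ≤ L ∧ Function.Injective c ∧ (∀ x, Adj (c x) (c (x + 1))) ∧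
      ∀ x y, Adj (c x) (c y) → y = x + 1 ∨ x = y + 1 := by
  classical
  obtain ⟨w₀, hw₀⟩ := hv₀
  -- closed walks that never turn back, except possibly at the base point
  let IsClosedWalk : ℕ → Prop := fun L ↦ 1 ≤ L ∧ ∃ v : ℕ → V, (∀ t < L, Adj (v t) (v (t + 1))) ∧
    (∀ t, t + 2 ≤ L → v t ≠ v (t + 2)) ∧ v 0 = v L
  have hex : ∃ L, IsClosedWalk L := by
    choose f hf1 hf2 using hnext
    let step : {p : V × V // Adj p.1 p.2} → {p : V × V // Adj p.1 p.2} :=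
      fun p ↦ ⟨(p.1.2, f p.1.1 p.1.2 p.2), hf1 _ _ _⟩
    let w : ℕ → {p : V × V // Adj p.1 p.2} := fun n ↦ step^[n] ⟨(v₀, w₀), hw₀⟩
    have hw : ∀ n, w (n + 1) = step (w n) := fun n ↦ Function.iterate_succ_apply' step n _
    let v : ℕ → V := fun n ↦ (w n).1.1
    have hv1 : ∀ n, v (n + 1) = (w n).1.2 := fun n ↦ by simp only [v, hw, step]
    have hv2 : ∀ n, v n ≠ v (n + 2) := fun n ↦ by
      rw [hv1 (n + 1), hw n]
      exact (hf2 _ _ _).symm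
    have hv3 : ∀ n, Adj (v n) (v (n + 1)) := fun n ↦ by
      rw [hv1]
      exact (w n).2
    obtain ⟨m, k, hmk, he⟩ := Finite.exists_ne_map_eq_of_infinite v
    wlog hlt : m < k generalizing m k
    · exact this k m hmk.symm he.symm (by omega)
    refine ⟨k - m, by omega, fun t ↦ v (m + t), fun t _ ↦ hv3 _, fun t _ ↦ hv2 _, ?_⟩
    simp only [add_zero]
    rw [he]
    congr 1
    omega
  set L := Nat.find hex with hL
  obtain ⟨hL1, v, hadj, hnb, hclosed⟩ := Nat.find_spec hex
  have hmin : ∀ M, M < L → ¬ IsClosedWalk M := fun M hM ↦ Nat.find_min hex hM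
  change 1 ≤ L at hL1
  change ∀ t < L, Adj (v t) (v (t + 1)) at hadj
  change ∀ t, t + 2 ≤ L → v t ≠ v (t + 2) at hnb
  change v 0 = v L at hclosed
  have hinj : ∀ a b, a < b → b < L → v a ≠ v b := by
    intro a b hab hb he
    refine hmin (b - a) (by omega) ⟨by omega, fun t ↦ v (a + t), fun t ht ↦ hadj _ (by omega),
      fun t ht ↦ hnb _ (by omega), ?_⟩
    simp only [add_zero]
    rw [he]
    congr 1
    omega
  have hchord : ∀ a b, a < b → b < L → Adj (v a) (v b) → b = a + 1 ∨ (a = 0 ∧ b + 1 = L) := by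
    intro a b hab hb he
    by_contra! hcon
    refine hmin (b - a + 1) (by omega) ⟨by omega, fun t ↦ if t ≤ b - a then v (a + t) else v a,
      fun t ht ↦ ?_, fun t ht ↦ ?_, ?_⟩
    · dsimp only
      rcases Nat.lt_or_ge t (b - a) with h | h
      · rw [if_pos (by omega), if_pos (by omega)]
        exact hadj _ (by omega)
      · obtain rfl : t = b - a := by omega
        rw [if_pos le_rfl, if_neg (by omega)]
        have : a + (b - a) = b := by omega
        rw [this]
        exact hsymm _ _ he
    · dsimp only
      rcases Nat.lt_or_ge (t + 1) (b - a) with h | h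
      · rw [if_pos (by omega), if_pos (by omega)]
        exact hnb _ (by omega)
      · rw [if_pos (by omega), if_neg (by omega)]
        exact (hinj _ _ (by omega) (by omega)).symm
    · simp
  have hne1 : L ≠ 1 := by
    intro h1
    have := hadj 0 (by omega)
    rw [hclosed, h1] at this
    exact hirr _ this
  have hne2 : L ≠ 2 := by
    intro h2
    have := hnb 0 (by omega)
    rw [hclosed, h2] at this
    exact this rfl
  have : NeZero L := ⟨by omega⟩
  have : Fact (1 < L) := ⟨by omega⟩
  have hval : ∀ x : ZMod L, (x + 1).val = x.val + 1 ∨ (x.val + 1 = L ∧ (x + 1).val = 0) := by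
    intro x
    have hx := x.val_lt
    rw [ZMod.val_add, ZMod.val_one]
    rcases Nat.lt_or_ge (x.val + 1) L with h | h
    · exact Or.inl (Nat.mod_eq_of_lt h)
    · refine Or.inr ⟨by omega, ?_⟩
      have : x.val + 1 = L := by omega
      rw [this, Nat.mod_self]
  have hsucc : ∀ x : ZMod L, v (x + 1).val = v (x.val + 1) := by
    intro x
    rcases hval x with h | ⟨h1, h2⟩
    · rw [h]
    · rw [h2, h1, hclosed]
  have key : ∀ x y : ZMod L, x.val < y.val → Adj (v x.val) (v y.val) → y = x + 1 ∨ x = y + 1 := by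
    intro x y hxy h
    have hy := y.val_lt
    rcases hchord _ _ hxy hy h with h1 | ⟨h1, h2⟩
    · left
      apply ZMod.val_injective L
      rcases hval x with h | ⟨h3, h4⟩
      · omega
      · omega
    · right
      apply ZMod.val_injective L
      rcases hval y with h | ⟨h3, h4⟩
      · have := (y + 1).val_lt
        omega
      · omega
  refine ⟨L, inferInstance, fun x ↦ v x.val, by omega, fun x y hxy ↦ ?_, fun x ↦ ?_, fun x y h ↦ ?_⟩
  · apply ZMod.val_injective L
    dsimp only at hxy
    have hx := x.val_lt
    have hy := y.val_lt
    rcases lt_trichotomy x.val y.val with h | h | h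
    · exact absurd hxy (hinj _ _ h hy)
    · exact h
    · exact absurd hxy.symm (hinj _ _ h hx)
  · dsimp only
    rw [hsucc]
    exact hadj _ x.val_lt
  · dsimp only at h
    rcases lt_trichotomy x.val y.val with h1 | h1 | h1
    · exact key x y h1 h
    · rw [h1] at h
      exact absurd h (hirr _)
    · exact (key y x h1 (hsymm _ _ h)).symm

/-- A bipartite incidence relation with at least as many right vertices as left ones, all right
vertices having degree at least two, has a nonempty part in which all degrees are at least two. -/
theorem exists_core {α β : Type*} [DecidableEq α] [DecidableEq β] (R : α → β → Prop) :
    ∀ (n : ℕ) (I : Finset α) (J : Finset β), I.card = n → I.card ≤ J.card → J.Nonempty →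
      (∀ j ∈ J, ∃ i ∈ I, ∃ i' ∈ I, i ≠ i' ∧ R i j ∧ R i' j) →
      ∃ (I' : Finset α) (J' : Finset β), J'.Nonempty ∧
        (∀ j ∈ J', ∃ i ∈ I', ∃ i' ∈ I', i ≠ i' ∧ R i j ∧ R i' j) ∧
        (∀ i ∈ I', ∃ j ∈ J', ∃ j' ∈ J', j ≠ j' ∧ R i j ∧ R i j') := by
  intro n
  induction n with
  | zero =>
    intro I J hn _ ⟨j, hj⟩ h
    obtain ⟨i, hi, -⟩ := h j hj
    rw [Finset.card_eq_zero.mp hn] at hi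
    simp at hi
  | succ n ih =>
    intro I J hn hc hJ h
    by_cases hI : ∀ i ∈ I, ∃ j ∈ J, ∃ j' ∈ J, j ≠ j' ∧ R i j ∧ R i j'
    · exact ⟨I, J, hJ, h, hI⟩
    push Not at hI
    obtain ⟨i, hi, hdeg⟩ := hI
    -- a left vertex of degree at most one is removed with its neighbour
    have hone : ∃ J₁ ⊆ J, J.card ≤ J₁.card + 1 ∧ ∀ j ∈ J₁, ¬ R i j := by
      by_cases hj : ∃ j ∈ J, R i j
      · obtain ⟨j, hj, hR⟩ := hj
        refine ⟨J.erase j, J.erase_subset j, by rw [Finset.card_erase_of_mem hj]; omega, ?_⟩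
        intro j' hj' hR'
        exact hdeg j hj j' (Finset.mem_of_mem_erase hj') (Finset.ne_of_mem_erase hj').symm hR hR'
      · push Not at hj
        exact ⟨J, subset_rfl, by omega, hj⟩
    obtain ⟨J₁, hJ₁, hcard, hJ₁R⟩ := hone
    have hIcard : 2 ≤ I.card := by
      obtain ⟨j, hj⟩ := hJ
      obtain ⟨a, ha, b, hb, hab, -⟩ := h j hj
      exact Finset.one_lt_card.mpr ⟨a, ha, b, hb, hab⟩
    have hE := Finset.card_erase_of_mem hi
    refine ih (I.erase i) J₁ (by omega) (by omega) (Finset.card_pos.mp (by omega)) ?_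
    intro j hj
    obtain ⟨a, ha, b, hb, hab, hRa, hRb⟩ := h j (hJ₁ hj)
    refine ⟨a, Finset.mem_erase.mpr ⟨?_, ha⟩, b, Finset.mem_erase.mpr ⟨?_, hb⟩, hab, hRa, hRb⟩
    · rintro rfl
      exact hJ₁R j hj hRa
    · rintro rfl
      exact hJ₁R j hj hRb

/-- A bipartite incidence relation with at least as many right vertices as left ones, all right
vertices having degree at least two, contains a chordless cycle
`j 0, i 0, j 1, i 1, …, j (r - 1), i (r - 1), j 0`. -/
theorem exists_chordless_bipartite_cycle {α β : Type*} (R : α → β → Prop)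
    (I : Finset α) (J : Finset β) (hcard : I.card ≤ J.card) (hJ : J.Nonempty)
    (hdeg : ∀ j ∈ J, ∃ i ∈ I, ∃ i' ∈ I, i ≠ i' ∧ R i j ∧ R i' j) :
    ∃ (r : ℕ) (_ : NeZero r) (i : ZMod r → α) (j : ZMod r → β), 2 ≤ r ∧
      Function.Injective i ∧ Function.Injective j ∧ (∀ t, i t ∈ I) ∧ (∀ t, j t ∈ J) ∧
      (∀ t, R (i t) (j t)) ∧ (∀ t, R (i t) (j (t + 1))) ∧
      ∀ t k, R (i t) (j k) → k = t ∨ k = t + 1 := by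
  classical
  obtain ⟨I', J', hJ', hd1, hd2, hI'I, hJ'J⟩ : ∃ (I' : Finset α) (J' : Finset β), J'.Nonempty ∧
        (∀ j ∈ J', ∃ i ∈ I', ∃ i' ∈ I', i ≠ i' ∧ R i j ∧ R i' j) ∧
        (∀ i ∈ I', ∃ j ∈ J', ∃ j' ∈ J', j ≠ j' ∧ R i j ∧ R i j') ∧ I' ⊆ I ∧ J' ⊆ J := by
    obtain ⟨I', J', ⟨j₀, hj₀⟩, hd1, hd2⟩ := exists_core (fun i j ↦ i ∈ I ∧ j ∈ J ∧ R i j) _ I J rfl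
      hcard hJ (fun j hj ↦ by
        obtain ⟨a, ha, b, hb, hab, h1, h2⟩ := hdeg j hj
        exact ⟨a, ha, b, hb, hab, ⟨ha, hj, h1⟩, ⟨hb, hj, h2⟩⟩)
    refine ⟨I', J', ⟨j₀, hj₀⟩, ?_, ?_, ?_, ?_⟩
    · intro j hj
      obtain ⟨a, ha, b, hb, hab, h1, h2⟩ := hd1 j hj
      exact ⟨a, ha, b, hb, hab, h1.2.2, h2.2.2⟩
    · intro j hj
      obtain ⟨a, ha, b, hb, hab, h1, h2⟩ := hd2 j hj
      exact ⟨a, ha, b, hb, hab, h1.2.2, h2.2.2⟩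
    · intro i hi
      obtain ⟨a, ha, b, hb, hab, h1, h2⟩ := hd2 i hi
      exact h1.1
    · intro i hi
      obtain ⟨a, ha, b, hb, hab, h1, h2⟩ := hd1 i hi
      exact h1.2.1
  let Adj : (I' ⊕ J') → (I' ⊕ J') → Prop := fun u v ↦ match u, v with
    | .inl i, .inr j => R i.1 j.1
    | .inr j, .inl i => R i.1 j.1
    | _, _ => False
  have hstep : ∀ v : I' ⊕ J', ∃ w w', w ≠ w' ∧ Adj v w ∧ Adj v w' := by
    rintro (⟨i, hi⟩ | ⟨j, hj⟩)
    · obtain ⟨a, ha, b, hb, hab, h1, h2⟩ := hd2 i hi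
      exact ⟨.inr ⟨a, ha⟩, .inr ⟨b, hb⟩, by simpa using hab, h1, h2⟩
    · obtain ⟨a, ha, b, hb, hab, h1, h2⟩ := hd1 j hj
      exact ⟨.inl ⟨a, ha⟩, .inl ⟨b, hb⟩, by simpa using hab, h1, h2⟩
  obtain ⟨j₀, hj₀⟩ := hJ'
  obtain ⟨L, hL, c, hL3, hc, hc1, hc2⟩ := exists_chordless_cycle Adj
    (by rintro (a | a) (b | b) h <;> exact h) (by rintro (a | a) <;> simp [Adj])
    (.inr ⟨j₀, hj₀⟩) (by
      intro u v _
      obtain ⟨w, w', h, h1, h2⟩ := hstep v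
      by_cases hw : w = u
      · exact ⟨w', h2, fun h' ↦ h (hw.trans h'.symm)⟩
      · exact ⟨w, h1, hw⟩) (by
      obtain ⟨w, w', h, h1, h2⟩ := hstep (.inr ⟨j₀, hj₀⟩)
      exact ⟨w, h1⟩)
  have hcol : ∀ x, (c (x + 1)).isLeft = !(c x).isLeft := by
    intro x
    have := hc1 x
    revert this
    rcases c x with a | a <;> rcases c (x + 1) with b | b <;> simp [Adj]
  -- base the cycle at a right vertex
  obtain ⟨x₀, hx₀⟩ : ∃ x₀, (c x₀).isLeft = false := by
    by_cases h : (c 0).isLeft = false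
    · exact ⟨0, h⟩
    · refine ⟨0 + 1, ?_⟩
      rw [hcol]
      simpa using h
  have hpar : ∀ n : ℕ, (c (x₀ + (2 * n : ℕ))).isLeft = false ∧
      (c (x₀ + (2 * n : ℕ) + 1)).isLeft = true := by
    intro n
    induction n with
    | zero => simp [hcol, hx₀]
    | succ n ih =>
      have e : x₀ + ((2 * (n + 1) : ℕ) : ZMod L) = x₀ + (2 * n : ℕ) + 1 + 1 := by
        push_cast
        ring
      have h1 : (c (x₀ + (2 * n : ℕ) + 1 + 1)).isLeft = false := by rw [hcol, ih.2]; rfl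
      refine ⟨by rw [e, h1], ?_⟩
      rw [e, hcol, h1]
      rfl
  have heven : ∃ r, L = 2 * r := by
    rcases Nat.even_or_odd' L with ⟨r, h | h⟩
    · exact ⟨r, h⟩
    · exfalso
      have h1 := (hpar r).2
      have : x₀ + ((2 * r : ℕ) : ZMod L) + 1 = x₀ := by
        have : ((2 * r + 1 : ℕ) : ZMod L) = 0 := by rw [← h]; simp
        push_cast at this ⊢
        rw [add_assoc, this, add_zero]
      rw [this, hx₀] at h1
      simp at h1
  obtain ⟨r, rfl⟩ := heven
  have hr0 : r ≠ 0 := fun h ↦ hL.out (by omega)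
  have : NeZero r := ⟨hr0⟩
  have : Fact (1 < r) := ⟨by omega⟩
  let x : ZMod r → ZMod (2 * r) := fun t ↦ x₀ + (2 * t.val : ℕ)
  have hx : ∀ t, x (t + 1) = x t + 1 + 1 := by
    intro t
    have hlt := t.val_lt
    have e : x t + 1 + 1 = x₀ + (2 * (t.val + 1) : ℕ) := by
      simp only [x]
      push_cast
      ring
    rw [e]
    simp only [x]
    rw [ZMod.val_add, ZMod.val_one]
    rcases Nat.lt_or_ge (t.val + 1) r with h | h
    · rw [Nat.mod_eq_of_lt h]
    · have h' : t.val + 1 = r := by omega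
      rw [h', Nat.mod_self, ZMod.natCast_self]
      simp
  have hxinj : Function.Injective x := by
    intro t t' h
    have h1 := t.val_lt
    have h2 := t'.val_lt
    have h3 : ((2 * t.val : ℕ) : ZMod (2 * r)) = (2 * t'.val : ℕ) := add_left_cancel h
    rw [ZMod.natCast_eq_natCast_iff', Nat.mod_eq_of_lt (by omega), Nat.mod_eq_of_lt (by omega)] at h3
    apply ZMod.val_injective r
    omega
  have hright : ∀ t, ∃ j : J', c (x t) = .inr j := by
    intro t
    have := (hpar t.val).1
    exact Sum.isRight_iff.mp (by simpa [x] using this)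
  have hleft : ∀ t, ∃ i : I', c (x t + 1) = .inl i := by
    intro t
    have := (hpar t.val).2
    exact Sum.isLeft_iff.mp this
  choose j hj using hright
  choose i hi using hleft
  refine ⟨r, inferInstance, fun t ↦ (i t).1, fun t ↦ (j t).1, by omega, ?_, ?_,
    fun t ↦ hI'I (i t).2, fun t ↦ hJ'J (j t).2, ?_, ?_, ?_⟩
  · intro t t' h
    have h' : i t = i t' := Subtype.ext h
    have h2 := hi t
    rw [h', ← hi t'] at h2
    exact hxinj (add_right_cancel (hc h2))
  · intro t t' h
    have h' : j t = j t' := Subtype.ext h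
    have h2 := hj t
    rw [h', ← hj t'] at h2
    exact hxinj (hc h2)
  · intro t
    have := hc1 (x t)
    rwa [hi, hj] at this
  · intro t
    have := hc1 (x t + 1)
    rwa [hi, ← hx, hj] at this
  · intro t k h
    have h' : Adj (c (x t + 1)) (c (x k)) := by
      rw [hi, hj]
      exact h
    rcases hc2 _ _ h' with h1 | h1
    · right
      rw [← hx] at h1
      exact hxinj h1
    · left
      exact hxinj (add_right_cancel h1).symm

/-! ### Winding numbers of closed polygons -/

/-- The oriented angle, in `(-π, π]`, under which the segment from `p` to `q` is seen from `z`; it is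
meaningful for `z` off the segment. -/
noncomputable def viewAngle (p q z : ℂ) : ℝ := Complex.arg ((q - z) / (p - z))

theorem div_mem_slitPlane_of_notMem_segment {p q z : ℂ} (h : z ∉ segment ℝ p q) :
    (q - z) / (p - z) ∈ Complex.slitPlane := by
  have hp : p - z ≠ 0 := fun h' ↦ h (by rw [← sub_eq_zero.mp h']; exact left_mem_segment ℝ p q)
  by_contra hcon
  rw [Complex.mem_slitPlane_iff_not_le_zero, not_not, Complex.le_def] at hcon
  obtain ⟨hre, him⟩ := hcon
  simp only [Complex.zero_re, Complex.zero_im] at hre him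
  set ρ := ((q - z) / (p - z)).re with hρ
  have h1 : q - z = (ρ : ℂ) * (p - z) := by
    rw [← div_eq_iff hp]
    apply Complex.ext <;> simp [hρ, him]
  apply h
  have h2 : (1 - (ρ : ℂ)) ≠ 0 := by
    norm_cast
    linarith
  refine ⟨-ρ / (1 - ρ), 1 / (1 - ρ), div_nonneg (by linarith) (by linarith),
    div_nonneg (by linarith) (by linarith), ?_, ?_⟩
  · have : (1 - ρ) ≠ 0 := by linarith
    field_simp
    ring
  · simp only [Complex.real_smul]
    push_cast
    field_simp
    linear_combination h1

theorem continuousAt_viewAngle {p q z : ℂ} (h : z ∉ segment ℝ p q) :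
    ContinuousAt (viewAngle p q) z := by
  have hp : p - z ≠ 0 := fun h' ↦ h (by rw [← sub_eq_zero.mp h']; exact left_mem_segment ℝ p q)
  have h1 : ContinuousAt (fun z ↦ (q - z) / (p - z)) z :=
    (continuousAt_const.sub continuousAt_id).div (continuousAt_const.sub continuousAt_id) hp
  exact ContinuousAt.comp (f := fun z ↦ (q - z) / (p - z)) (g := Complex.arg)
    (Complex.continuousAt_arg (div_mem_slitPlane_of_notMem_segment h)) h1

theorem coe_viewAngle {p q z : ℂ} (hp : z ≠ p) (hq : z ≠ q) :
    (viewAngle p q z : Real.Angle) = Complex.arg (q - z) - Complex.arg (p - z) :=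
  Complex.arg_div_coe_angle (sub_ne_zero.mpr hq.symm) (sub_ne_zero.mpr hp.symm)

/-- The total angle under which the closed polygon with vertices `a` is seen from `z`, that is,
`2π` times the winding number of the polygon around `z`. -/
noncomputable def windAngle {r : ℕ} [NeZero r] (a : ZMod r → ℂ) (z : ℂ) : ℝ :=
  ∑ t, viewAngle (a (t - 1)) (a t) z

theorem sum_sub_pred {r : ℕ} [NeZero r] {M : Type*} [AddCommGroup M] (f : ZMod r → M) :
    ∑ t, (f t - f (t - 1)) = 0 := by
  rw [Finset.sum_sub_distrib, sub_eq_zero]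
  exact (Equiv.sum_comp (Equiv.subRight (1 : ZMod r)) f).symm

/-- The winding number is an integer. -/
theorem exists_windAngle_eq {r : ℕ} [NeZero r] (a : ZMod r → ℂ) (z : ℂ) (hz : ∀ t, z ≠ a t) :
    ∃ k : ℤ, windAngle a z = k * (2 * Real.pi) := by
  have h : ((windAngle a z : ℝ) : Real.Angle) = 0 := by
    rw [windAngle]
    have : ((∑ t, viewAngle (a (t - 1)) (a t) z : ℝ) : Real.Angle) =
        ∑ t, (viewAngle (a (t - 1)) (a t) z : Real.Angle) :=
      map_sum Real.Angle.coeHom _ _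
    rw [this, ← sum_sub_pred (fun t ↦ (Complex.arg (a t - z) : Real.Angle))]
    exact Finset.sum_congr rfl fun t _ ↦ coe_viewAngle (hz _) (hz _)
  rw [← Real.Angle.coe_zero, Real.Angle.angle_eq_iff_two_pi_dvd_sub] at h
  obtain ⟨k, hk⟩ := h
  exact ⟨k, by linarith⟩

theorem continuousAt_windAngle {r : ℕ} [NeZero r] {a : ZMod r → ℂ} {z : ℂ}
    (h : ∀ t, z ∉ segment ℝ (a (t - 1)) (a t)) : ContinuousAt (windAngle a) z :=
  tendsto_finsetSum _ fun t _ ↦ continuousAt_viewAngle (h t)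

/-- The winding number is constant on convex sets which the polygon does not meet. -/
theorem windAngle_eq_of_convex {r : ℕ} [NeZero r] {a : ZMod r → ℂ} {S : Set ℂ}
    (hS : Convex ℝ S) (h : ∀ z ∈ S, ∀ t, z ∉ segment ℝ (a (t - 1)) (a t)) {z w : ℂ}
    (hz : z ∈ S) (hw : w ∈ S) : windAngle a z = windAngle a w := by
  have hdisc : IsDiscrete (Set.range fun k : ℤ ↦ (k : ℝ) * (2 * Real.pi)) := by
    have : Set.range (fun k : ℤ ↦ (k : ℝ) * (2 * Real.pi)) =
        (AddSubgroup.zmultiples (2 * Real.pi) : Set ℝ) := by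
      ext x
      simp [AddSubgroup.mem_zmultiples_iff]
    rw [this]
    exact ⟨inferInstanceAs (DiscreteTopology (AddSubgroup.zmultiples (2 * Real.pi)))⟩
  refine hS.isPreconnected.constant_of_mapsTo hdisc
    (fun x hx ↦ (continuousAt_windAngle (h x hx)).continuousWithinAt) ?_ hz hw
  intro x hx
  obtain ⟨k, hk⟩ := exists_windAngle_eq a x fun t ht ↦ h x hx t (ht ▸ right_mem_segment ℝ _ _)
  exact ⟨k, hk.symm⟩

theorem arg_div_eq_sub {x y : ℂ} (hx : x ≠ 0) (hy : y ≠ 0) {k : ℤ}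
    (h : x.arg - y.arg + 2 * Real.pi * k ∈ Set.Ioc (-Real.pi) Real.pi) :
    (x / y).arg = x.arg - y.arg + 2 * Real.pi * k := by
  have h1 : ((x / y).arg : Real.Angle) = ((x.arg - y.arg + 2 * Real.pi * k : ℝ) : Real.Angle) := by
    rw [Complex.arg_div_coe_angle hx hy, ← Real.Angle.coe_sub,
      Real.Angle.angle_eq_iff_two_pi_dvd_sub]
    exact ⟨-k, by push_cast; ring⟩
  rw [← Real.Angle.toReal_coe_eq_self_iff_mem_Ioc.mpr h, ← h1, Complex.arg_coe_angle_toReal_eq_arg]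

/-- The winding number around a point above all vertices is zero. -/
theorem windAngle_eq_zero_of_im_lt {r : ℕ} [NeZero r] {a : ZMod r → ℂ} {z : ℂ}
    (h : ∀ t, (a t).im < z.im) : windAngle a z = 0 := by
  rw [windAngle, ← sum_sub_pred (fun t ↦ Complex.arg (Complex.I * (a t - z)))]
  refine Finset.sum_congr rfl fun t _ ↦ ?_
  have hre : ∀ t, 0 < (Complex.I * (a t - z)).re := fun t ↦ by
    simpa using h t
  have hne : ∀ t, Complex.I * (a t - z) ≠ 0 := fun t h0 ↦ by
    have := hre t
    rw [h0] at this
    simp at this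
  have habs : ∀ t, |Complex.arg (Complex.I * (a t - z))| < Real.pi / 2 := fun t ↦
    Complex.abs_arg_lt_pi_div_two_iff.mpr (Or.inl (hre t))
  have h1 := abs_lt.mp (habs t)
  have h2 := abs_lt.mp (habs (t - 1))
  rw [viewAngle, ← mul_div_mul_left _ _ Complex.I_ne_zero]
  rw [arg_div_eq_sub (k := 0) (hne t) (hne _) ⟨by push_cast; linarith, by push_cast; linarith⟩]
  simp

/-- The signed number of times the segment from `p` to `q` crosses the vertical line with abscissa
`x`, positive if it does so from left to right. -/
noncomputable def crossingSign (x : ℝ) (p q : ℂ) : ℝ :=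
  (if x < q.re then 1 else 0) - (if x < p.re then 1 else 0)

/-- The height at which the line through `p` and `q` meets the vertical line with abscissa `x`. -/
noncomputable def crossingHeight (x : ℝ) (p q : ℂ) : ℝ :=
  p.im + (x - p.re) / (q.re - p.re) * (q.im - p.im)

/-- The angle of view of a segment, compared with the change of the argument whose branch cut is
the vertical ray going down. -/
theorem viewAngle_eq {p q z : ℂ} (hp : p.re ≠ z.re) (hq : q.re ≠ z.re)
    (h : crossingSign z.re p q ≠ 0 → crossingHeight z.re p q ≠ z.im) :
    viewAngle p q z = Complex.arg (-Complex.I * (q - z)) - Complex.arg (-Complex.I * (p - z)) +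
      2 * Real.pi * (if crossingHeight z.re p q < z.im then crossingSign z.re p q else 0) := by
  have hI : -Complex.I ≠ 0 := neg_ne_zero.mpr Complex.I_ne_zero
  have hne : ∀ w : ℂ, w.re ≠ z.re → -Complex.I * (w - z) ≠ 0 := fun w hw h0 ↦ by
    rcases mul_eq_zero.mp h0 with h | h
    · exact hI h
    · exact hw (by rw [sub_eq_zero.mp h])
  have him : ∀ w : ℂ, (-Complex.I * (w - z)).im = z.re - w.re := fun w ↦ by simp
  have hneg : ∀ w : ℂ, z.re < w.re → -Real.pi < Complex.arg (-Complex.I * (w - z)) ∧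
      Complex.arg (-Complex.I * (w - z)) < 0 := fun w hw ↦
    ⟨Complex.neg_pi_lt_arg _, Complex.arg_neg_iff.mpr (by rw [him]; linarith)⟩
  have hpos : ∀ w : ℂ, w.re < z.re → 0 < Complex.arg (-Complex.I * (w - z)) ∧
      Complex.arg (-Complex.I * (w - z)) < Real.pi := fun w hw ↦ by
    have h0 : 0 < (-Complex.I * (w - z)).im := by rw [him]; linarith
    refine ⟨lt_of_le_of_ne (Complex.arg_nonneg_iff.mpr h0.le) fun h' ↦ ?_,
      lt_of_le_of_ne (Complex.arg_le_pi _) fun h' ↦ ?_⟩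
    · exact h0.ne' (Complex.arg_eq_zero_iff.mp h'.symm).2
    · exact h0.ne' (Complex.arg_eq_pi_iff.mp h').2
  have hπ := Real.pi_pos
  rw [viewAngle, ← mul_div_mul_left _ _ hI]
  -- the sign of the sine of the angle of view
  have hsin : ((-Complex.I * (q - z)) * (starRingEnd ℂ) (-Complex.I * (p - z))).im =
      (z.re - q.re) * (p.im - z.im) - (z.re - p.re) * (q.im - z.im) := by
    simp
    ring
  have hsin' : ((-Complex.I * (q - z)) * (starRingEnd ℂ) (-Complex.I * (p - z))).im =
      ‖-Complex.I * (q - z)‖ * ‖-Complex.I * (p - z)‖ *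
      Real.sin (Complex.arg (-Complex.I * (q - z)) - Complex.arg (-Complex.I * (p - z))) := by
    have e1 := Complex.norm_mul_sin_arg (-Complex.I * (q - z))
    have e2 := Complex.norm_mul_sin_arg (-Complex.I * (p - z))
    have e3 := Complex.norm_mul_cos_arg (-Complex.I * (q - z))
    have e4 := Complex.norm_mul_cos_arg (-Complex.I * (p - z))
    rw [Real.sin_sub, Complex.mul_im, Complex.conj_re, Complex.conj_im, ← e1, ← e2, ← e3, ← e4]
    ring
  have hn : 0 < ‖-Complex.I * (q - z)‖ * ‖-Complex.I * (p - z)‖ :=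
    mul_pos (norm_pos_iff.mpr (hne q hq)) (norm_pos_iff.mpr (hne p hp))
  rw [hsin] at hsin'
  have hheight : q.re ≠ p.re → (z.re - q.re) * (p.im - z.im) - (z.re - p.re) * (q.im - z.im) =
      (q.re - p.re) * (z.im - crossingHeight z.re p q) := fun hqp ↦ by
    have : q.re - p.re ≠ 0 := sub_ne_zero.mpr hqp
    rw [crossingHeight]
    field_simp
    ring
  set θ := Complex.arg (-Complex.I * (q - z)) with hθ
  set φ := Complex.arg (-Complex.I * (p - z)) with hφ
  have hfin : ∀ k : ℤ, (if crossingHeight z.re p q < z.im then crossingSign z.re p q else 0) = k →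
      -Real.pi < θ - φ + 2 * Real.pi * k → θ - φ + 2 * Real.pi * k < Real.pi →
      Complex.arg ((-Complex.I * (q - z)) / (-Complex.I * (p - z))) = θ - φ + 2 * Real.pi *
        (if crossingHeight z.re p q < z.im then crossingSign z.re p q else 0) := by
    intro k hk h1 h2
    rw [hk]
    exact arg_div_eq_sub (hne q hq) (hne p hp) ⟨h1, h2.le⟩
  rcases lt_or_gt_of_ne hp with hp' | hp' <;> rcases lt_or_gt_of_ne hq with hq' | hq'
  · have hs : crossingSign z.re p q = 0 := by
      simp [crossingSign, not_lt.mpr hp'.le, not_lt.mpr hq'.le]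
    have h1 := hpos p hp'
    have h2 := hpos q hq'
    exact hfin 0 (by simp [hs]) (by push_cast; linarith) (by push_cast; linarith)
  · have hs : crossingSign z.re p q = 1 := by
      simp [crossingSign, not_lt.mpr hp'.le, hq']
    have h1 := hpos p hp'
    have h2 := hneg q hq'
    rw [hheight (by linarith)] at hsin'
    rcases lt_or_gt_of_ne (h (by rw [hs]; norm_num)) with hH | hH
    · have hs0 : 0 < Real.sin (θ - φ) := by
        have := mul_pos (show 0 < q.re - p.re by linarith) (sub_pos.mpr hH)
        rw [hsin'] at this
        exact (mul_pos_iff_of_pos_left hn).mp this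
      have : θ - φ < -Real.pi := by
        by_contra! hcon
        exact absurd (Real.sin_nonpos_of_nonpos_of_neg_pi_le (by linarith) hcon) (not_le.mpr hs0)
      exact hfin 1 (by simp [hs, hH]) (by push_cast; linarith) (by push_cast; linarith)
    · have hs0 : Real.sin (θ - φ) < 0 := by
        have := mul_pos (show 0 < q.re - p.re by linarith) (sub_pos.mpr hH)
        by_contra! hcon
        nlinarith [mul_nonneg hn.le hcon]
      have : -Real.pi < θ - φ := by
        by_contra! hcon
        have h3 : 0 ≤ Real.sin (θ - φ + 2 * Real.pi) :=
          Real.sin_nonneg_of_nonneg_of_le_pi (by linarith) (by linarith)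
        rw [Real.sin_add_two_pi] at h3
        linarith
      exact hfin 0 (by simp [not_lt.mpr hH.le]) (by push_cast; linarith) (by push_cast; linarith)
  · have hs : crossingSign z.re p q = -1 := by
      simp [crossingSign, not_lt.mpr hq'.le, hp']
    have h1 := hneg p hp'
    have h2 := hpos q hq'
    rw [hheight (by linarith)] at hsin'
    rcases lt_or_gt_of_ne (h (by rw [hs]; norm_num)) with hH | hH
    · have hs0 : Real.sin (θ - φ) < 0 := by
        have := mul_pos (show 0 < p.re - q.re by linarith) (sub_pos.mpr hH)
        by_contra! hcon
        nlinarith [mul_nonneg hn.le hcon]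
      have : Real.pi < θ - φ := by
        by_contra! hcon
        exact absurd (Real.sin_nonneg_of_nonneg_of_le_pi (by linarith) hcon) (not_le.mpr hs0)
      exact hfin (-1) (by simp [hs, hH]) (by push_cast; linarith) (by push_cast; linarith)
    · have hs0 : 0 < Real.sin (θ - φ) := by
        have := mul_pos (show 0 < p.re - q.re by linarith) (sub_pos.mpr hH)
        refine (mul_pos_iff_of_pos_left hn).mp ?_
        rw [← hsin']
        linarith
      have : θ - φ < Real.pi := by
        by_contra! hcon
        have h3 : Real.sin (θ - φ - 2 * Real.pi) ≤ 0 :=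
          Real.sin_nonpos_of_nonpos_of_neg_pi_le (by linarith) (by linarith)
        rw [Real.sin_sub_two_pi] at h3
        linarith
      exact hfin 0 (by simp [not_lt.mpr hH.le]) (by push_cast; linarith) (by push_cast; linarith)
  · have hs : crossingSign z.re p q = 0 := by
      simp [crossingSign, hp', hq']
    have h1 := hneg p hp'
    have h2 := hneg q hq'
    exact hfin 0 (by simp [hs]) (by push_cast; linarith) (by push_cast; linarith)

/-- The winding number around a point is the signed number of crossings of the polygon with the
vertical ray going down from it. -/
theorem windAngle_eq_sum_crossingSign {r : ℕ} [NeZero r] {a : ZMod r → ℂ} {z : ℂ}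
    (hz : ∀ t, (a t).re ≠ z.re) (h : ∀ t, crossingSign z.re (a (t - 1)) (a t) ≠ 0 →
      crossingHeight z.re (a (t - 1)) (a t) ≠ z.im) :
    windAngle a z = 2 * Real.pi * ∑ t, (if crossingHeight z.re (a (t - 1)) (a t) < z.im then
      crossingSign z.re (a (t - 1)) (a t) else 0) := by
  rw [windAngle, Finset.sum_congr rfl fun t _ ↦ viewAngle_eq (hz _) (hz t) (h t),
    Finset.sum_add_distrib, sum_sub_pred (fun t ↦ Complex.arg (-Complex.I * (a t - z))), zero_add,
    Finset.mul_sum]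

/-- If a point approaches the midpoint of a segment from the left, the angle under which it sees the
segment tends to `π`; if it does so from the right, the angle tends to `-π`. -/
theorem tendsto_viewAngle_midpoint {p d : ℂ} (hd : d ≠ 0) :
    Filter.Tendsto (fun ε : ℝ ↦ viewAngle p (p + d) (p + d / 2 + ε * Complex.I * d))
      (nhdsWithin 0 (Set.Ioi 0)) (nhds Real.pi) ∧
    Filter.Tendsto (fun ε : ℝ ↦ viewAngle p (p + d) (p + d / 2 - ε * Complex.I * d))
      (nhdsWithin 0 (Set.Ioi 0)) (nhds (-Real.pi)) := by
  have hne : ∀ ε : ℝ, (1 / 2 + ε * Complex.I : ℂ) ≠ 0 := fun ε h0 ↦ by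
    have := congrArg Complex.re h0
    simp at this
  have hform : ∀ ε : ℝ, viewAngle p (p + d) (p + d / 2 + ε * Complex.I * d) =
      Complex.arg (-((1 / 2 - ε * Complex.I) / (1 / 2 + ε * Complex.I))) := by
    intro ε
    rw [viewAngle]
    congr 1
    have h1 : p + d - (p + d / 2 + ε * Complex.I * d) = d * (1 / 2 - ε * Complex.I) := by ring
    have h2 : p - (p + d / 2 + ε * Complex.I * d) = d * -(1 / 2 + ε * Complex.I) := by ring
    rw [h1, h2, mul_div_mul_left _ _ hd, div_neg]
  have hcont : Continuous fun ε : ℝ ↦ -((1 / 2 - ε * Complex.I) / (1 / 2 + ε * Complex.I) : ℂ) :=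
    Continuous.neg (Continuous.div (by fun_prop) (by fun_prop) hne)
  have him : ∀ ε : ℝ, (-((1 / 2 - ε * Complex.I) / (1 / 2 + ε * Complex.I) : ℂ)).im =
      ε / (1 / 4 + ε ^ 2) := by
    intro ε
    have h0 : (1 / 4 + ε ^ 2 : ℝ) ≠ 0 := by positivity
    have hn : Complex.normSq (1 / 2 + ε * Complex.I) = 1 / 4 + ε ^ 2 := by
      simp [Complex.normSq_apply]
      ring
    rw [Complex.neg_im, Complex.div_im, hn]
    simp
    ring
  have hm1 : Filter.Tendsto (fun ε : ℝ ↦ -((1 / 2 - ε * Complex.I) / (1 / 2 + ε * Complex.I) : ℂ))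
      (nhds 0) (nhds (-1)) := by
    have := hcont.tendsto 0
    simpa using this
  constructor
  · simp_rw [hform]
    have := Complex.tendsto_arg_nhdsWithin_im_nonneg_of_re_neg_of_im_zero (z := -1) (by simp)
      (by simp)
    refine this.comp (tendsto_nhdsWithin_iff.mpr ⟨hm1.mono_left nhdsWithin_le_nhds, ?_⟩)
    filter_upwards [self_mem_nhdsWithin] with ε hε
    have hε' : 0 < ε := hε
    change 0 ≤ Complex.im _
    rw [him]
    positivity
  · have hneg : ∀ ε : ℝ, viewAngle p (p + d) (p + d / 2 - ε * Complex.I * d) =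
        Complex.arg (-((1 / 2 - (-ε : ℝ) * Complex.I) / (1 / 2 + (-ε : ℝ) * Complex.I))) := by
      intro ε
      rw [← hform]
      congr 1
      push_cast
      ring
    simp_rw [hneg]
    have := Complex.tendsto_arg_nhdsWithin_im_neg_of_re_neg_of_im_zero (z := -1) (by simp)
      (by simp)
    have hm2 : Filter.Tendsto (fun ε : ℝ ↦ -ε) (nhdsWithin 0 (Set.Ioi 0)) (nhds 0) := by
      have : Filter.Tendsto (fun ε : ℝ ↦ -ε) (nhds 0) (nhds (-0)) := continuous_neg.tendsto 0
      rw [neg_zero] at this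
      exact this.mono_left nhdsWithin_le_nhds
    refine this.comp (tendsto_nhdsWithin_iff.mpr ⟨hm1.comp hm2, ?_⟩)
    filter_upwards [self_mem_nhdsWithin] with ε hε
    have hε' : 0 < ε := hε
    change Complex.im _ < 0
    rw [him]
    have : 0 < ε / (1 / 4 + (-ε) ^ 2) := by positivity
    rw [neg_div]
    linarith

/-! ### Tight polygons and their cells -/

/-- A closed polygon `a` in the plane together with complex lines `y = s t * x + b t` such that the
function `u = min_t Re (s t * x + b t)` is attained at the vertex `a t` by the lines `t` and `t + 1`,
with equal imaginary parts, and by no other line. -/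
structure IsTightPolygon {r : ℕ} (a s b : ZMod r → ℂ) : Prop where
  three_le : 3 ≤ r
  tie : ∀ t, s t * a t + b t = s (t + 1) * a t + b (t + 1)
  lt : ∀ t k, k ≠ t → k ≠ t + 1 → (s t * a t + b t).re < (s k * a t + b k).re

/-- The cell of the line `t`: the closed convex set on which `Re (s t * x + b t)` is minimal. -/
def minCell {r : ℕ} (s b : ZMod r → ℂ) (t : ZMod r) : Set ℂ :=
  {z | ∀ k, (s t * z + b t).re ≤ (s k * z + b k).re}

/-- The signed area spanned by `d` and `w`, positive if `w` is to the left of `d`. -/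
noncomputable def crossProd (d w : ℂ) : ℝ := d.re * w.im - d.im * w.re

theorem convex_minCell {r : ℕ} (s b : ZMod r → ℂ) (t : ZMod r) : Convex ℝ (minCell s b t) := by
  intro z hz w hw α β hα hβ hαβ k
  have h1 := mul_le_mul_of_nonneg_left (hz k) hα
  have h2 := mul_le_mul_of_nonneg_left (hw k) hβ
  simp only [Complex.add_re, Complex.mul_re, Complex.real_smul, Complex.ofReal_re,
    Complex.ofReal_im, Complex.add_im, Complex.mul_im] at *
  have e1 : (b t).re = (α + β) * (b t).re := by rw [hαβ, one_mul]
  have e2 : (b k).re = (α + β) * (b k).re := by rw [hαβ, one_mul]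
  rw [e1, e2]
  linarith

theorem exists_mem_minCell {r : ℕ} [NeZero r] (s b : ZMod r → ℂ) (z : ℂ) :
    ∃ t, z ∈ minCell s b t := by
  obtain ⟨t, -, ht⟩ := Finset.exists_min_image Finset.univ (fun k ↦ (s k * z + b k).re)
    ⟨0, Finset.mem_univ _⟩
  exact ⟨t, fun k ↦ ht k (Finset.mem_univ k)⟩

/-- The part of the cell `t` on the left (`η = 1`) or right (`η = -1`) of the edge `t`. -/
def halfCell {r : ℕ} (a s b : ZMod r → ℂ) (η : ℝ) (t : ZMod r) : Set ℂ :=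
  {z | z ∈ minCell s b t ∧ 0 < η * crossProd (a t - a (t - 1)) (z - a t)}

theorem convex_halfCell {r : ℕ} (a s b : ZMod r → ℂ) (η : ℝ) (t : ZMod r) :
    Convex ℝ (halfCell a s b η t) := by
  intro z hz w hw α β hα hβ hαβ
  refine ⟨convex_minCell s b t hz.1 hw.1 hα hβ hαβ, ?_⟩
  have h1 := hz.2
  have h2 := hw.2
  obtain rfl : β = 1 - α := by linarith
  have e : η * crossProd (a t - a (t - 1)) (α • z + (1 - α) • w - a t) =
      α * (η * crossProd (a t - a (t - 1)) (z - a t)) +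
      (1 - α) * (η * crossProd (a t - a (t - 1)) (w - a t)) := by
    simp [crossProd]
    ring
  rw [e]
  rcases hα.eq_or_lt with rfl | hα
  · simpa using h2
  · have := mul_pos hα h1
    have := mul_nonneg hβ h2.le
    linarith

theorem exists_eq_add_mul_of_crossProd_eq_zero {p d z : ℂ} (hd : d ≠ 0) (h : crossProd d (z - p) = 0) :
    ∃ τ : ℝ, z = p + τ * d := by
  have hn : d.re * d.re + d.im * d.im ≠ 0 := by
    intro h0
    exact hd (Complex.ext (by simp; nlinarith) (by simp; nlinarith))
  rw [crossProd] at h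
  refine ⟨(d.re * (z - p).re + d.im * (z - p).im) / (d.re * d.re + d.im * d.im), ?_⟩
  apply Complex.ext
  · simp only [Complex.add_re, Complex.re_ofReal_mul, Complex.sub_re, Complex.sub_im] at *
    rw [div_mul_eq_mul_div, ← sub_eq_iff_eq_add', eq_div_iff hn]
    linear_combination -d.im * h
  · simp only [Complex.add_im, Complex.im_ofReal_mul, Complex.sub_re, Complex.sub_im] at *
    rw [div_mul_eq_mul_div, ← sub_eq_iff_eq_add', eq_div_iff hn]
    linear_combination d.re * h

namespace IsTightPolygon

variable {r : ℕ} {a s b : ZMod r → ℂ}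

theorem natCast_ne_zero (h : IsTightPolygon a s b) {n : ℕ} (h0 : 0 < n) (hn : n < 3) :
    (n : ZMod r) ≠ 0 := by
  rw [Ne, ZMod.natCast_eq_zero_iff]
  intro hd
  have := Nat.le_of_dvd h0 hd
  have := h.three_le
  omega

theorem one_ne_zero (h : IsTightPolygon a s b) : (1 : ZMod r) ≠ 0 := by
  simpa using h.natCast_ne_zero (n := 1) (by norm_num) (by norm_num)

theorem two_ne_zero (h : IsTightPolygon a s b) : (2 : ZMod r) ≠ 0 := by
  simpa using h.natCast_ne_zero (n := 2) (by norm_num) (by norm_num)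

theorem tie_pred (h : IsTightPolygon a s b) (t : ZMod r) :
    s (t - 1) * a (t - 1) + b (t - 1) = s t * a (t - 1) + b t := by
  have := h.tie (t - 1)
  rwa [sub_add_cancel] at this

/-- The polygon leaves the cell `t` at the vertex `a t`, entering the cell `t + 1`. -/
theorem re_mul_sub_pos (h : IsTightPolygon a s b) (t : ZMod r) :
    0 < ((s t - s (t + 1)) * (a t - a (t - 1))).re := by
  have h1 := h.lt (t - 1) (t + 1) (fun e ↦ h.two_ne_zero (by linear_combination e))
    (fun e ↦ h.one_ne_zero (by linear_combination e))
  have h2 := h.tie_pred t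
  have e : (s t - s (t + 1)) * (a t - a (t - 1)) = s (t + 1) * a (t - 1) + b (t + 1) -
      (s (t - 1) * a (t - 1) + b (t - 1)) := by
    linear_combination h.tie t + h2
  rw [e, Complex.sub_re]
  linarith

theorem re_mul_sub_pos' (h : IsTightPolygon a s b) (t : ZMod r) :
    0 < ((s t - s (t + 1)) * (a (t + 1) - a t)).re := by
  have h1 := h.lt (t + 1) t (fun e ↦ h.one_ne_zero (by linear_combination -e))
    (fun e ↦ h.two_ne_zero (by linear_combination -e))
  have e : (s t - s (t + 1)) * (a (t + 1) - a t) = s t * a (t + 1) + b t -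
      (s (t + 1) * a (t + 1) + b (t + 1)) := by
    linear_combination -h.tie t
  rw [e, Complex.sub_re]
  linarith

theorem sub_ne_zero' (h : IsTightPolygon a s b) (t : ZMod r) : a t - a (t - 1) ≠ 0 := by
  intro h0
  have := h.re_mul_sub_pos t
  simp [h0] at this

/-- The integral of the complex slope along the polygon vanishes, as `s t * (a t - a (t - 1))` is the
change of the function `s t * x + b t`, which is continuous along the polygon. -/
theorem sum_mul_sub [NeZero r] (h : IsTightPolygon a s b) :
    ∑ t, s t * (a t - a (t - 1)) = 0 := by
  rw [← sum_sub_pred (fun t ↦ s t * a t + b t)]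
  refine Finset.sum_congr rfl fun t _ ↦ ?_
  linear_combination h.tie_pred t

theorem vertex_mem (h : IsTightPolygon a s b) (t : ZMod r) : a t ∈ minCell s b t := by
  intro k
  by_cases h1 : k = t
  · rw [h1]
  by_cases h2 : k = t + 1
  · rw [h2, h.tie]
  · exact (h.lt t k h1 h2).le

theorem vertex_pred_mem (h : IsTightPolygon a s b) (t : ZMod r) : a (t - 1) ∈ minCell s b t := by
  intro k
  rw [← h.tie_pred]
  exact h.vertex_mem (t - 1) k

theorem eq_of_vertex_mem (h : IsTightPolygon a s b) {t k : ZMod r} (hk : a k ∈ minCell s b t) :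
    t = k ∨ t = k + 1 := by
  by_contra! hcon
  exact absurd (hk k) (not_le.mpr (h.lt k t hcon.1 hcon.2))

/-- In the interior of an edge of the polygon, the minimum is attained by one line only. -/
theorem lt_of_mem_openSegment (h : IsTightPolygon a s b) {t k : ZMod r} (hkt : k ≠ t) {z : ℂ}
    (hz : z ∈ openSegment ℝ (a (t - 1)) (a t)) : (s t * z + b t).re < (s k * z + b k).re := by
  obtain ⟨α, β, hα, hβ, hαβ, rfl⟩ := hz
  have h1 := h.vertex_mem t k
  have h2 := h.vertex_pred_mem t k
  have h3 : (s t * a t + b t).re < (s k * a t + b k).re ∨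
      (s t * a (t - 1) + b t).re < (s k * a (t - 1) + b k).re := by
    by_cases hk : k = t + 1
    · right
      rw [← h.tie_pred]
      refine h.lt _ _ ?_ ?_
      · rw [hk]
        exact fun e ↦ h.two_ne_zero (by linear_combination e)
      · rw [hk]
        exact fun e ↦ h.one_ne_zero (by linear_combination e)
    · exact Or.inl (h.lt t k hkt hk)
  have e : ∀ l, (s l * (α • a (t - 1) + β • a t) + b l).re =
      α * (s l * a (t - 1) + b l).re + β * (s l * a t + b l).re := by
    intro l
    simp only [Complex.add_re, Complex.mul_re, Complex.real_smul, Complex.ofReal_re,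
      Complex.ofReal_im, Complex.add_im, Complex.mul_im]
    linear_combination -(b l).re * hαβ
  rw [e, e]
  rcases h3 with h3 | h3
  · have := mul_lt_mul_of_pos_left h3 hβ
    have := mul_le_mul_of_nonneg_left h2 hα.le
    linarith
  · have := mul_lt_mul_of_pos_left h3 hα
    have := mul_le_mul_of_nonneg_left h1 hβ.le
    linarith

/-- The polygon meets the cell `t` only in its edge `t`. -/
theorem crossProd_eq_zero (h : IsTightPolygon a s b) {t k : ZMod r} {z : ℂ}
    (hz : z ∈ minCell s b t) (hk : z ∈ segment ℝ (a (k - 1)) (a k)) :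
    crossProd (a t - a (t - 1)) (z - a t) = 0 := by
  by_cases hkt : k = t
  · rw [hkt] at hk
    obtain ⟨α, β, hα, hβ, hαβ, rfl⟩ := hk
    obtain rfl : β = 1 - α := by linarith
    simp [crossProd]
    ring
  rcases eq_or_ne z (a (k - 1)) with rfl | h1
  · rcases h.eq_of_vertex_mem hz with rfl | h2
    · simp [crossProd]
    · exact absurd (by linear_combination -h2) hkt
  rcases eq_or_ne z (a k) with rfl | h2
  · rcases h.eq_of_vertex_mem hz with h2 | rfl
    · exact absurd h2.symm hkt
    · rw [add_sub_cancel_right]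
      simp [crossProd]
      ring
  · have := h.lt_of_mem_openSegment (Ne.symm hkt)
      (mem_openSegment_of_ne_left_right h1.symm h2.symm hk)
    exact absurd (hz k) (not_le.mpr this)

/-- Close to the vertex `a t`, the common boundary of the cells `t` and `t + 1` runs along a
straight line. -/
theorem eventually_mem_minCell [NeZero r] (h : IsTightPolygon a s b) (t : ZMod r) :
    ∀ᶠ ε : ℝ in nhds 0, a t + ε * Complex.I * (starRingEnd ℂ) (s t - s (t + 1)) ∈ minCell s b t ∧
      a t + ε * Complex.I * (starRingEnd ℂ) (s t - s (t + 1)) ∈ minCell s b (t + 1) := by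
  have heq : ∀ ε : ℝ, (s t * (a t + ε * Complex.I * (starRingEnd ℂ) (s t - s (t + 1))) + b t).re =
      (s (t + 1) * (a t + ε * Complex.I * (starRingEnd ℂ) (s t - s (t + 1))) + b (t + 1)).re := by
    intro ε
    have := congrArg Complex.re (h.tie t)
    simp only [Complex.add_re, Complex.mul_re, Complex.add_im, Complex.mul_im, Complex.ofReal_re,
      Complex.ofReal_im, Complex.I_re, Complex.I_im, Complex.conj_re, Complex.conj_im,
      Complex.sub_re, Complex.sub_im] at *
    linear_combination this
  have hev : ∀ k, ∀ᶠ ε : ℝ in nhds 0,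
      (s t * (a t + ε * Complex.I * (starRingEnd ℂ) (s t - s (t + 1))) + b t).re ≤
      (s k * (a t + ε * Complex.I * (starRingEnd ℂ) (s t - s (t + 1))) + b k).re := by
    intro k
    by_cases h1 : k = t
    · rw [h1]
      exact Filter.Eventually.of_forall fun _ ↦ le_rfl
    by_cases h2 : k = t + 1
    · rw [h2]
      exact Filter.Eventually.of_forall fun ε ↦ (heq ε).le
    · have hc : ∀ l, Continuous fun ε : ℝ ↦
          (s l * (a t + ε * Complex.I * (starRingEnd ℂ) (s t - s (t + 1))) + b l).re := fun l ↦
        Complex.continuous_re.comp (by fun_prop)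
      have := ((hc t).tendsto 0).eventually_lt ((hc k).tendsto 0) (by simpa using h.lt t k h1 h2)
      exact this.mono fun _ ↦ le_of_lt
  filter_upwards [Filter.eventually_all.mpr hev] with ε hε
  exact ⟨hε, fun k ↦ (heq ε) ▸ hε k⟩

theorem windAngle_eq_of_mem_halfCell [NeZero r] (h : IsTightPolygon a s b) {η : ℝ} {t : ZMod r}
    {z w : ℂ} (hz : z ∈ halfCell a s b η t) (hw : w ∈ halfCell a s b η t) :
    windAngle a z = windAngle a w := by
  refine windAngle_eq_of_convex (convex_halfCell a s b η t) (fun x hx k hk ↦ ?_) hz hw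
  have := hx.2
  rw [h.crossProd_eq_zero hx.1 hk, mul_zero] at this
  exact lt_irrefl 0 this

/-- Consecutive cells have points of the same side of the polygon in common. -/
theorem exists_mem_halfCell [NeZero r] (h : IsTightPolygon a s b) {η : ℝ} (hη : η ≠ 0)
    (t : ZMod r) : ∃ z, z ∈ halfCell a s b η t ∧ z ∈ halfCell a s b η (t + 1) := by
  have hlim : Filter.Tendsto (fun δ : ℝ ↦ δ * η) (nhdsWithin 0 (Set.Ioi 0)) (nhds 0) := by
    have : Filter.Tendsto (fun δ : ℝ ↦ δ * η) (nhds 0) (nhds (0 * η)) :=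
      (continuous_mul_const η).tendsto 0
    rw [zero_mul] at this
    exact this.mono_left nhdsWithin_le_nhds
  obtain ⟨δ, hδ, hδ0⟩ := ((hlim.eventually (h.eventually_mem_minCell t)).and
    self_mem_nhdsWithin).exists
  have hδ0 : 0 < δ := hδ0
  have hpos : 0 < δ * (η * η) := mul_pos hδ0 (mul_self_pos.mpr hη)
  refine ⟨_, ⟨hδ.1, ?_⟩, ⟨hδ.2, ?_⟩⟩
  · refine (mul_pos hpos (h.re_mul_sub_pos t)).trans_eq ?_
    simp [crossProd]
    ring
  · rw [add_sub_cancel_right]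
    refine (mul_pos hpos (h.re_mul_sub_pos' t)).trans_eq ?_
    simp [crossProd]
    ring

/-- All points on the same side of the polygon in the various cells have the same winding number. -/
theorem exists_windAngle_eq_on_side [NeZero r] (h : IsTightPolygon a s b) {η : ℝ} (hη : η ≠ 0) :
    ∃ w : ℝ, ∀ t, ∀ z ∈ halfCell a s b η t, windAngle a z = w := by
  choose c hc hc' using h.exists_mem_halfCell hη
  have hstep : ∀ t, windAngle a (c (t + 1)) = windAngle a (c t) := fun t ↦
    h.windAngle_eq_of_mem_halfCell (hc (t + 1)) (hc' t)
  have hall : ∀ n : ℕ, windAngle a (c (n : ZMod r)) = windAngle a (c 0) := by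
    intro n
    induction n with
    | zero => simp
    | succ n ih => rw [Nat.cast_succ, hstep, ih]
  refine ⟨windAngle a (c 0), fun t z hz ↦ ?_⟩
  rw [h.windAngle_eq_of_mem_halfCell hz (hc t), ← hall t.val, ZMod.natCast_zmod_val]

/-- Every point off the polygon is on a definite side of it. -/
theorem exists_mem_halfCell_of_notMem [NeZero r] (h : IsTightPolygon a s b) {z : ℂ}
    (hz : ∀ t, z ∉ segment ℝ (a (t - 1)) (a t)) :
    ∃ t, z ∈ halfCell a s b 1 t ∨ z ∈ halfCell a s b (-1) t := by
  obtain ⟨t, ht⟩ := exists_mem_minCell s b z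
  refine ⟨t, ?_⟩
  rcases lt_trichotomy 0 (crossProd (a t - a (t - 1)) (z - a t)) with h1 | h1 | h1
  · exact Or.inl ⟨ht, by linarith⟩
  · exfalso
    obtain ⟨τ, hτ⟩ := exists_eq_add_mul_of_crossProd_eq_zero (h.sub_ne_zero' t) h1.symm
    -- beyond its end points, the edge is continued outside of the cell
    have hτ0 : τ ≤ 0 := by
      by_contra! hcon
      have h2 := mul_pos hcon (h.re_mul_sub_pos t)
      have e : s t * z + b t = s (t + 1) * z + b (t + 1) +
          τ * ((s t - s (t + 1)) * (a t - a (t - 1))) := by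
        rw [hτ]
        linear_combination h.tie t
      have h3 := ht (t + 1)
      rw [e, Complex.add_re, Complex.re_ofReal_mul] at h3
      linarith
    have hτ1 : -1 ≤ τ := by
      by_contra! hcon
      have h2 := h.re_mul_sub_pos' (t - 1)
      rw [sub_add_cancel] at h2
      have h2 := mul_pos (show 0 < -1 - τ by linarith) h2
      have e : s t * z + b t = s (t - 1) * z + b (t - 1) +
          (-1 - τ : ℝ) * ((s (t - 1) - s t) * (a t - a (t - 1))) := by
        rw [hτ]
        push_cast
        linear_combination -h.tie_pred t
      have h3 := ht (t - 1)
      rw [e, Complex.add_re, Complex.re_ofReal_mul] at h3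
      linarith
    refine hz t ⟨-τ, 1 + τ, by linarith, by linarith, by ring, ?_⟩
    rw [hτ]
    simp only [Complex.real_smul]
    push_cast
    ring
  · exact Or.inr ⟨ht, by linarith⟩

/-- The edges of the polygon do not meet in their interiors. -/
theorem notMem_segment_of_mem_openSegment (h : IsTightPolygon a s b) {t k : ZMod r} (hkt : k ≠ t)
    {z : ℂ} (hz : z ∈ openSegment ℝ (a (t - 1)) (a t)) : z ∉ segment ℝ (a (k - 1)) (a k) := by
  intro hk
  have hvert : ∀ l, z ≠ a l := by
    rintro l rfl
    by_cases hl : l = t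
    · have h1 := h.lt_of_mem_openSegment (k := l + 1) (fun e ↦ h.one_ne_zero
        (by linear_combination e - hl)) hz
      rw [← hl, h.tie] at h1
      exact lt_irrefl _ h1
    · have h1 := h.lt_of_mem_openSegment hl hz
      exact absurd (h.vertex_mem l t) (not_le.mpr h1)
  have h1 := h.lt_of_mem_openSegment hkt hz
  have h2 := h.lt_of_mem_openSegment (Ne.symm hkt)
    (mem_openSegment_of_ne_left_right (hvert _).symm (hvert _).symm hk)
  exact lt_asymm h1 h2

/-- The winding numbers on the two sides of the polygon differ by one. -/
theorem windAngle_sub_eq [NeZero r] (h : IsTightPolygon a s b) {w w' : ℝ}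
    (hw : ∀ t, ∀ z ∈ halfCell a s b 1 t, windAngle a z = w)
    (hw' : ∀ t, ∀ z ∈ halfCell a s b (-1) t, windAngle a z = w') : w - w' = 2 * Real.pi := by
  classical
  set p := a (0 - 1) with hp
  set d := a 0 - p with hd
  have hd0 : d ≠ 0 := h.sub_ne_zero' 0
  have hpd : a 0 = p + d := by rw [hd]; ring
  have hm : p + d / 2 ∈ openSegment ℝ (a (0 - 1)) (a 0) := by
    refine ⟨1 / 2, 1 / 2, by norm_num, by norm_num, by norm_num, ?_⟩
    rw [hpd, ← hp]
    simp only [Complex.real_smul]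
    push_cast
    ring
  have hnn : 0 < d.re * d.re + d.im * d.im := by
    have := Complex.normSq_pos.mpr hd0
    rwa [Complex.normSq_apply] at this
  -- the points at distance `ε` from the midpoint of the edge `0` stay in the cell
  have hcell : ∀ η : ℝ, ∀ᶠ ε : ℝ in nhdsWithin 0 (Set.Ioi 0),
      p + d / 2 + η * ε * Complex.I * d ∈ minCell s b 0 := by
    intro η
    refine Filter.Eventually.filter_mono nhdsWithin_le_nhds (Filter.eventually_all.mpr fun k ↦ ?_)
    by_cases hk : k = 0
    · rw [hk]
      exact Filter.Eventually.of_forall fun _ ↦ le_rfl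
    · have hc : ∀ l, Continuous fun ε : ℝ ↦
          (s l * (p + d / 2 + η * ε * Complex.I * d) + b l).re := fun l ↦
        Complex.continuous_re.comp (by fun_prop)
      exact (((hc 0).tendsto 0).eventually_lt ((hc k).tendsto 0)
        (by simpa using h.lt_of_mem_openSegment hk hm)).mono fun _ ↦ le_of_lt
  have hside : ∀ η ε : ℝ, crossProd (a 0 - a (0 - 1)) (p + d / 2 + η * ε * Complex.I * d - a 0) =
      η * ε * (d.re * d.re + d.im * d.im) := by
    intro η ε
    have h1 : a 0 - a (0 - 1) = d := rfl
    have h2 : p + d / 2 + η * ε * Complex.I * d - a 0 = ((η * ε : ℝ) * Complex.I - (1 / 2 : ℝ)) * d := by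
      rw [hpd]
      push_cast
      ring
    rw [h1, h2]
    simp only [crossProd, Complex.mul_re, Complex.mul_im, Complex.sub_re, Complex.sub_im,
      Complex.ofReal_re, Complex.ofReal_im, Complex.I_re, Complex.I_im]
    ring
  -- the contribution of the other edges is continuous at the midpoint
  let rest : ℂ → ℝ := fun z ↦ ∑ t ∈ Finset.univ.erase (0 : ZMod r), viewAngle (a (t - 1)) (a t) z
  have hsplit : ∀ z, windAngle a z = viewAngle p (p + d) z + rest z := fun z ↦ by
    rw [windAngle, ← Finset.add_sum_erase _ _ (Finset.mem_univ (0 : ZMod r)), ← hp, hpd]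
  have hrest : ContinuousAt rest (p + d / 2) :=
    tendsto_finsetSum _ fun t ht ↦ continuousAt_viewAngle
      (h.notMem_segment_of_mem_openSegment (Finset.ne_of_mem_erase ht) hm)
  have hlim : ∀ η : ℝ, Filter.Tendsto (fun ε : ℝ ↦ rest (p + d / 2 + η * ε * Complex.I * d))
      (nhdsWithin 0 (Set.Ioi 0)) (nhds (rest (p + d / 2))) := by
    intro η
    have hc : Continuous fun ε : ℝ ↦ p + d / 2 + η * ε * Complex.I * d := by fun_prop
    have : Filter.Tendsto (fun ε : ℝ ↦ p + d / 2 + η * ε * Complex.I * d) (nhds 0)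
        (nhds (p + d / 2)) := by simpa using hc.tendsto 0
    exact (hrest.tendsto.comp this).mono_left nhdsWithin_le_nhds
  obtain ⟨hv1, hv2⟩ := tendsto_viewAngle_midpoint (p := p) hd0
  have e1 : w = Real.pi + rest (p + d / 2) := by
    refine tendsto_nhds_unique_of_eventuallyEq tendsto_const_nhds (hv1.add (hlim 1)) ?_
    filter_upwards [hcell 1, self_mem_nhdsWithin] with ε h1 h2
    have h2 : 0 < ε := h2
    rw [← hw 0 _ ⟨h1, by rw [hside]; positivity⟩, hsplit]
    simp
  have e2 : w' = -Real.pi + rest (p + d / 2) := by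
    refine tendsto_nhds_unique_of_eventuallyEq tendsto_const_nhds (hv2.add (hlim (-1))) ?_
    filter_upwards [hcell (-1), self_mem_nhdsWithin] with ε h1 h2
    have h2 : 0 < ε := h2
    rw [← hw' 0 _ ⟨h1, by rw [hside]; linarith [mul_pos h2 hnn]⟩, hsplit]
    simp [sub_eq_add_neg]
  linarith

/-- The polygon is a simple closed curve: up to orientation, the winding number is `0` or `1`. -/
theorem exists_sign_windAngle [NeZero r] (h : IsTightPolygon a s b) :
    ∃ η : ℝ, η ≠ 0 ∧ ∀ z, (∀ t, z ∉ segment ℝ (a (t - 1)) (a t)) → 0 ≤ η * windAngle a z := by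
  obtain ⟨w, hw⟩ := h.exists_windAngle_eq_on_side (η := 1) (by norm_num)
  obtain ⟨w', hw'⟩ := h.exists_windAngle_eq_on_side (η := -1) (by norm_num)
  have hsub := h.windAngle_sub_eq hw hw'
  have hval : ∀ z, (∀ t, z ∉ segment ℝ (a (t - 1)) (a t)) →
      windAngle a z = w ∨ windAngle a z = w' := fun z hz ↦ by
    obtain ⟨t, ht | ht⟩ := h.exists_mem_halfCell_of_notMem hz
    · exact Or.inl (hw t z ht)
    · exact Or.inr (hw' t z ht)
  obtain ⟨M, hM⟩ : ∃ M : ℝ, ∀ t, (a t).im < M := by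
    obtain ⟨t, ht⟩ := Finite.exists_max fun t ↦ (a t).im
    exact ⟨(a t).im + 1, fun k ↦ by linarith [ht k]⟩
  have hfar : ∀ t, (M * Complex.I) ∉ segment ℝ (a (t - 1)) (a t) := by
    rintro t ⟨α, β, hα, hβ, hαβ, e⟩
    have := congrArg Complex.im e
    simp at this
    have h1 := mul_le_mul_of_nonneg_left (hM (t - 1)).le hα
    have h2 := mul_le_mul_of_nonneg_left (hM t).le hβ
    have h3 : α * (a (t - 1)).im + β * (a t).im < α * M + β * M := by
      rcases hα.eq_or_lt with rfl | hα
      · have hβ1 : β = 1 := by linarith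
        rw [hβ1]
        linarith [hM t]
      · linarith [mul_lt_mul_of_pos_left (hM (t - 1)) hα]
    rw [← add_mul, hαβ, this] at h3
    linarith
  have hzero := windAngle_eq_zero_of_im_lt (a := a) (z := M * Complex.I) (by simpa using hM)
  have hπ := Real.pi_pos
  rcases hval _ hfar with h1 | h1
  · refine ⟨-1, by norm_num, fun z hz ↦ ?_⟩
    rcases hval z hz with h2 | h2 <;> rw [h2] <;> linarith
  · refine ⟨1, by norm_num, fun z hz ↦ ?_⟩
    rcases hval z hz with h2 | h2 <;> rw [h2] <;> linarith

end IsTightPolygon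

/-! ### The flux through a tight polygon -/

/-- Summation by parts: weights with nonnegative partial sums, in the order given by `τ`, have
a positive sum against a decreasing positive function. -/
theorem sum_mul_sub_pos_of_partialSums_nonneg {ι : Type*} (w τ : ι → ℝ) (T : Finset ι) :
    Set.InjOn τ T → T.Nonempty → (∀ t ∈ T, w t ≠ 0) →
    (∀ t₀ ∈ T, 0 ≤ ∑ t ∈ T with τ t ≤ τ t₀, w t) →
    ∀ κ, (∀ t ∈ T, τ t < κ) → 0 < ∑ t ∈ T, w t * (κ - τ t) := by
  classical
  induction T using Finset.induction_on_max_value τ with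
  | empty => intro _ h; simp at h
  | insert m S hm hmax ih =>
    intro hinj _ hw hpart κ hκ
    have hlt : ∀ t ∈ S, τ t < τ m := fun t ht ↦ lt_of_le_of_ne (hmax t ht) fun e ↦ hm
      (hinj (by simp [ht]) (by simp) e ▸ ht)
    have htot : 0 ≤ w m + ∑ t ∈ S, w t := by
      have := hpart m (Finset.mem_insert_self _ _)
      rwa [Finset.filter_true_of_mem, Finset.sum_insert hm] at this
      intro t ht
      rcases Finset.mem_insert.mp ht with rfl | ht
      · exact le_rfl
      · exact hmax t ht
    have hκm := hκ m (Finset.mem_insert_self _ _)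
    rw [Finset.sum_insert hm]
    rcases S.eq_empty_or_nonempty with rfl | hS
    · have := hw m (Finset.mem_insert_self _ _)
      simp only [Finset.sum_empty, add_zero] at *
      exact mul_pos (lt_of_le_of_ne htot this.symm) (by linarith)
    · have h1 := ih (hinj.mono (by simp)) hS (fun t ht ↦ hw t (Finset.mem_insert_of_mem ht))
        (fun t₀ ht₀ ↦ by
          have := hpart t₀ (Finset.mem_insert_of_mem ht₀)
          rwa [Finset.filter_insert, if_neg (not_le.mpr (hlt t₀ ht₀))] at this) (τ m) hlt
      have h2 : ∑ t ∈ S, w t * (κ - τ t) =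
          ∑ t ∈ S, w t * (τ m - τ t) + (κ - τ m) * ∑ t ∈ S, w t := by
        rw [Finset.mul_sum, ← Finset.sum_add_distrib]
        exact Finset.sum_congr rfl fun t _ ↦ by ring
      rw [h2]
      have := mul_nonneg (sub_pos.mpr hκm).le htot
      linarith

theorem lt_and_lt_of_crossingSign_ne_zero {x : ℝ} {p q : ℂ} (hp : p.re ≠ x) (hq : q.re ≠ x)
    (h : crossingSign x p q ≠ 0) : (p.re < x ∧ x < q.re) ∨ (q.re < x ∧ x < p.re) := by
  rcases lt_or_gt_of_ne hp with hp' | hp' <;> rcases lt_or_gt_of_ne hq with hq' | hq'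
  · simp [crossingSign, not_lt.mpr hp'.le, not_lt.mpr hq'.le] at h
  · exact Or.inl ⟨hp', hq'⟩
  · exact Or.inr ⟨hq', hp'⟩
  · simp [crossingSign, hp', hq'] at h

theorem mem_openSegment_crossing {x : ℝ} {p q : ℂ} (hp : p.re ≠ x) (hq : q.re ≠ x)
    (h : crossingSign x p q ≠ 0) : (⟨x, crossingHeight x p q⟩ : ℂ) ∈ openSegment ℝ p q := by
  have h' := lt_and_lt_of_crossingSign_ne_zero hp hq h
  have hne : q.re - p.re ≠ 0 := by rcases h' with h' | h' <;> intro h0 <;> linarith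
  have h1 : 0 < (x - p.re) / (q.re - p.re) := by
    rcases h' with h' | h'
    · exact div_pos (by linarith) (by linarith)
    · exact div_pos_of_neg_of_neg (by linarith) (by linarith)
  have h2 : 0 < 1 - (x - p.re) / (q.re - p.re) := by
    have : 1 - (x - p.re) / (q.re - p.re) = (q.re - x) / (q.re - p.re) := by field_simp; ring
    rw [this]
    rcases h' with h' | h'
    · exact div_pos (by linarith) (by linarith)
    · exact div_pos_of_neg_of_neg (by linarith) (by linarith)
  refine ⟨_, _, h2, h1, by ring, ?_⟩
  apply Complex.ext
  · rw [Complex.add_re, Complex.smul_re, Complex.smul_re, smul_eq_mul, smul_eq_mul]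
    field_simp
    ring
  · rw [Complex.add_im, Complex.smul_im, Complex.smul_im, smul_eq_mul, smul_eq_mul, crossingHeight]
    ring

theorem crossing_of_mem_segment {p q z : ℂ} (hp : p.re ≠ z.re) (hq : q.re ≠ z.re)
    (h : z ∈ segment ℝ p q) :
    crossingSign z.re p q ≠ 0 ∧ crossingHeight z.re p q = z.im := by
  obtain ⟨α, β, hα, hβ, hαβ, rfl⟩ := h
  have hre : (α • p + β • q).re = p.re + β * (q.re - p.re) := by
    simp
    linear_combination p.re * hαβ
  have him : (α • p + β • q).im = p.im + β * (q.im - p.im) := by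
    simp
    linear_combination p.im * hαβ
  rw [hre] at hp hq ⊢
  rw [him]
  have hne : q.re - p.re ≠ 0 := fun h0 ↦ hp (by rw [h0]; ring)
  have hβ0 : 0 < β := lt_of_le_of_ne hβ fun h0 ↦ hp (by rw [← h0]; ring)
  have hβ1 : 0 < 1 - β := lt_of_le_of_ne (by linarith) fun h0 ↦ hq (by
    obtain rfl : β = 1 := by linarith
    ring)
  constructor
  · rcases lt_or_gt_of_ne hne with h | h
    · have h1 := mul_neg_of_pos_of_neg hβ0 h
      have h2 := mul_neg_of_pos_of_neg hβ1 h
      rw [crossingSign, if_neg (by linarith), if_pos (by linarith)]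
      norm_num
    · have h1 := mul_pos hβ0 h
      have h2 := mul_pos hβ1 h
      rw [crossingSign, if_pos (by linarith), if_neg (by linarith)]
      norm_num
  · rw [crossingHeight]
    field_simp
    ring

namespace IsTightPolygon

variable {r : ℕ} {a s b : ZMod r → ℂ}

/-- Along a vertical line, `u` is concave, so its slope changes monotonically from one edge of the
polygon to the next one above it. -/
theorem im_lt_of_crossingHeight_le (h : IsTightPolygon a s b) {x : ℝ} (hx : ∀ t, (a t).re ≠ x)
    {t k : ZMod r} (htk : k ≠ t) (ht : crossingSign x (a (t - 1)) (a t) ≠ 0)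
    (hk : crossingSign x (a (k - 1)) (a k) ≠ 0)
    (hle : crossingHeight x (a (t - 1)) (a t) ≤ crossingHeight x (a (k - 1)) (a k)) :
    (s t).im < (s k).im := by
  have h1 := h.lt_of_mem_openSegment htk (mem_openSegment_crossing (hx _) (hx _) ht)
  have h2 := h.lt_of_mem_openSegment htk.symm (mem_openSegment_crossing (hx _) (hx _) hk)
  simp only [Complex.add_re, Complex.mul_re] at h1 h2
  by_contra! hcon
  nlinarith [mul_nonneg (sub_nonneg.mpr hle) (sub_nonneg.mpr hcon)]

/-- If the orientation `η` makes the winding numbers nonnegative, every vertical line which meets the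
polygon contributes negatively to the sum. -/
theorem sum_crossingSign_mul_im_neg [NeZero r] (h : IsTightPolygon a s b) {η : ℝ} (hη : η ≠ 0)
    (hwind : ∀ z, (∀ t, z ∉ segment ℝ (a (t - 1)) (a t)) → 0 ≤ η * windAngle a z)
    {x : ℝ} (hx : ∀ t, (a t).re ≠ x) (hcross : ∃ t, crossingSign x (a (t - 1)) (a t) ≠ 0) :
    η * ∑ t, crossingSign x (a (t - 1)) (a t) * (s t).im < 0 := by
  classical
  set σ : ZMod r → ℝ := fun t ↦ crossingSign x (a (t - 1)) (a t) with hσ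
  set H : ZMod r → ℝ := fun t ↦ crossingHeight x (a (t - 1)) (a t) with hH
  set T : Finset (ZMod r) := Finset.univ.filter fun t ↦ σ t ≠ 0 with hT
  have hmem : ∀ {t}, t ∈ T ↔ σ t ≠ 0 := fun {t} ↦ by simp [hT]
  have horder : ∀ t ∈ T, ∀ k ∈ T, k ≠ t → H t ≤ H k → (s t).im < (s k).im :=
    fun t ht k hk htk hle ↦
      h.im_lt_of_crossingHeight_le hx htk (hmem.mp ht) (hmem.mp hk) hle
  have hinj : Set.InjOn (fun t ↦ (s t).im) T := by
    intro t ht k hk e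
    by_contra hne
    rcases le_total (H t) (H k) with hle | hle
    · exact (horder t ht k hk (Ne.symm hne) hle).ne e
    · exact (horder k hk t ht hne hle).ne e.symm
  have hiff : ∀ t ∈ T, ∀ k ∈ T, ((s t).im ≤ (s k).im ↔ H t ≤ H k) := by
    intro t ht k hk
    rcases eq_or_ne k t with rfl | hne
    · simp
    constructor
    · intro hle
      by_contra! hcon
      exact absurd hle (not_le.mpr (horder k hk t ht hne.symm hcon.le))
    · exact fun hle ↦ (horder t ht k hk hne hle).le
  have hpart : ∀ t₀ ∈ T, 0 ≤ ∑ t ∈ T with (s t).im ≤ (s t₀).im, η * σ t := by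
    intro t₀ ht₀
    -- a height just above the crossing `t₀`
    obtain ⟨y, hy, hy0⟩ : ∃ y, (∀ t, H t₀ < H t → y < H t) ∧ H t₀ < y := by
      have hev : ∀ᶠ y in nhdsWithin (H t₀) (Set.Ioi (H t₀)), ∀ t, H t₀ < H t → y < H t :=
        Filter.Eventually.filter_mono nhdsWithin_le_nhds
          (Filter.eventually_all.mpr fun t ↦ by
            by_cases ht : H t₀ < H t
            · exact (eventually_lt_nhds ht).mono fun _ h _ ↦ h
            · exact Filter.Eventually.of_forall fun _ h ↦ absurd h ht)
      exact (hev.and self_mem_nhdsWithin).exists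
    have hylt : ∀ t, H t < y ↔ H t ≤ H t₀ := fun t ↦
      ⟨fun h1 ↦ by by_contra! h2; exact lt_asymm h1 (hy t h2), fun h1 ↦ lt_of_le_of_lt h1 hy0⟩
    have hyne : ∀ t, H t ≠ y := fun t e ↦ by
      rcases le_or_gt (H t) (H t₀) with h1 | h1
      · linarith
      · exact (hy t h1).ne' e
    have hoff : ∀ t, (⟨x, y⟩ : ℂ) ∉ segment ℝ (a (t - 1)) (a t) := fun t ht ↦
      hyne t (crossing_of_mem_segment (hx _) (hx _) ht).2
    have hw := hwind ⟨x, y⟩ hoff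
    rw [windAngle_eq_sum_crossingSign hx fun t _ ↦ hyne t] at hw
    have hsum : ∑ t ∈ T with (s t).im ≤ (s t₀).im, η * σ t =
        η * ∑ t, (if H t < y then σ t else 0) := by
      rw [Finset.mul_sum, hT, Finset.filter_filter, Finset.sum_filter]
      refine Finset.sum_congr rfl fun t _ ↦ ?_
      by_cases ht : σ t = 0
      · simp [ht]
      · have := hiff t (hmem.mpr ht) t₀ ht₀
        rw [← hylt] at this
        by_cases hyt : H t < y
        · rw [if_pos ⟨ht, this.mpr hyt⟩, if_pos hyt]
        · rw [if_neg fun h' ↦ hyt (this.mp h'.2), if_neg hyt, mul_zero]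
    rw [hsum]
    have hπ := Real.pi_pos
    have e : η * (2 * Real.pi * ∑ t, (if H t < y then σ t else 0)) =
        2 * Real.pi * (η * ∑ t, (if H t < y then σ t else 0)) := by ring
    change 0 ≤ η * (2 * Real.pi * ∑ t, (if H t < y then σ t else 0)) at hw
    rw [e] at hw
    exact nonneg_of_mul_nonneg_right hw (by positivity)
  obtain ⟨κ, hκ⟩ : ∃ κ : ℝ, ∀ t, (s t).im < κ := by
    obtain ⟨t, ht⟩ := Finite.exists_max fun t ↦ (s t).im
    exact ⟨(s t).im + 1, fun k ↦ by linarith [ht k]⟩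
  obtain ⟨t₁, ht₁⟩ := hcross
  have hpos := sum_mul_sub_pos_of_partialSums_nonneg (fun t ↦ η * σ t) (fun t ↦ (s t).im) T hinj
    ⟨t₁, hmem.mpr ht₁⟩ (fun t ht ↦ mul_ne_zero hη (hmem.mp ht)) hpart κ fun t _ ↦ hκ t
  have hall : ∑ t ∈ T, η * σ t * (κ - (s t).im) = ∑ t, η * σ t * (κ - (s t).im) := by
    refine Finset.sum_subset (Finset.subset_univ _) fun t _ ht ↦ ?_
    have : σ t = 0 := by
      by_contra hne
      exact ht (hmem.mpr hne)
    simp [this]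
  have hzero : ∑ t, σ t = 0 := sum_sub_pred fun t ↦ if x < (a t).re then (1 : ℝ) else 0
  rw [hall] at hpos
  have e : ∑ t, η * σ t * (κ - (s t).im) = η * κ * ∑ t, σ t - η * ∑ t, σ t * (s t).im := by
    rw [Finset.mul_sum, Finset.mul_sum, ← Finset.sum_sub_distrib]
    exact Finset.sum_congr rfl fun t _ ↦ by ring
  rw [e, hzero, mul_zero] at hpos
  linarith

end IsTightPolygon

/-- The integral of the crossing signs over all vertical lines is the signed width of the segment. -/
theorem integral_crossingSign {M : ℝ} {p q : ℂ} (hp : |p.re| ≤ M) (hq : |q.re| ≤ M) :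
    IntervalIntegrable (fun x ↦ crossingSign x p q) MeasureTheory.volume (-M) M ∧
    ∫ x in -M..M, crossingSign x p q = q.re - p.re := by
  have key : ∀ c : ℝ, |c| ≤ M →
      IntervalIntegrable (fun x ↦ if x < c then (1 : ℝ) else 0) MeasureTheory.volume (-M) M ∧
      ∫ x in -M..M, (if x < c then (1 : ℝ) else 0) = c + M := by
    intro c hc
    have h1 := abs_le.mp hc
    have hf : (fun x : ℝ ↦ if x < c then (1 : ℝ) else 0) = (Set.Iio c).indicator fun _ ↦ 1 := by
      ext x
      simp [Set.indicator_apply]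
    rw [hf]
    have hint : ∀ u v : ℝ, IntervalIntegrable ((Set.Iio c).indicator fun _ ↦ (1 : ℝ))
        MeasureTheory.volume u v := fun u v ↦ by
      rw [intervalIntegrable_iff]
      exact (MeasureTheory.integrableOn_const (by simp)).indicator measurableSet_Iio
    refine ⟨hint _ _, ?_⟩
    rw [intervalIntegral.integral_of_le (by linarith),
      MeasureTheory.setIntegral_indicator measurableSet_Iio]
    have h2 : Set.Ioc (-M) M ∩ Set.Iio c = Set.Ioo (-M) c := by
      ext x
      simp only [Set.mem_inter_iff, Set.mem_Ioc, Set.mem_Iio, Set.mem_Ioo]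
      constructor
      · exact fun h ↦ ⟨h.1.1, h.2⟩
      · exact fun h ↦ ⟨⟨h.1, by linarith⟩, h.2⟩
    rw [h2]
    simp
    linarith
  obtain ⟨hp1, hp2⟩ := key _ hp
  obtain ⟨hq1, hq2⟩ := key _ hq
  refine ⟨hq1.sub hp1, ?_⟩
  simp only [crossingSign]
  rw [intervalIntegral.integral_sub hq1 hp1, hq2, hp2]
  ring

namespace IsTightPolygon

variable {r : ℕ} {a s b : ZMod r → ℂ}

/-- The vertices of the polygon do not lie on a vertical line. -/
theorem exists_re_ne [NeZero r] (h : IsTightPolygon a s b) : ∃ t, (a (t - 1)).re ≠ (a t).re := by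
  by_contra! hcon
  have hd : ∀ t, (a t - a (t - 1)).re = 0 := fun t ↦ by simp [hcon t]
  have hsame : ∀ t, 0 < (a t - a (t - 1)).im * (a (t + 1) - a t).im := by
    intro t
    have h1 := h.re_mul_sub_pos t
    have h2 := h.re_mul_sub_pos' t
    have h3 := hd (t + 1)
    rw [add_sub_cancel_right] at h3
    rw [Complex.mul_re, hd, mul_zero] at h1
    rw [Complex.mul_re, h3, mul_zero] at h2
    have := mul_pos h1 h2
    have h4 : 0 < (s t - s (t + 1)).im * (s t - s (t + 1)).im := by
      apply mul_self_pos.mpr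
      intro h0
      rw [h0] at h1
      simp at h1
    exact (mul_pos_iff_of_pos_right h4).mp (by linarith)
  have hsum := sum_sub_pred fun t ↦ (a t).im
  have hall : ∀ n : ℕ, 0 < (a 0 - a (0 - 1)).im * (a n - a (n - 1)).im := by
    intro n
    induction n with
    | zero =>
      have := hsame 0
      have h0 : (a 0 - a (0 - 1)).im ≠ 0 := fun h0 ↦ by rw [h0] at this; simp at this
      simpa using mul_self_pos.mpr h0
    | succ n ih =>
      have h1 := mul_pos ih (hsame n)
      push_cast
      rw [add_sub_cancel_right]
      have h0 : 0 < (a n - a (n - 1)).im * (a n - a (n - 1)).im := by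
        apply mul_self_pos.mpr
        intro h0
        rw [h0] at ih
        simp at ih
      exact (mul_pos_iff_of_pos_right h0).mp (by linarith)
  have hpos : 0 < ∑ t : ZMod r, (a 0 - a (0 - 1)).im * ((a t).im - (a (t - 1)).im) := by
    refine Finset.sum_pos (fun t _ ↦ ?_) ⟨0, Finset.mem_univ _⟩
    have := hall t.val
    rwa [ZMod.natCast_zmod_val] at this
  rw [← Finset.mul_sum, hsum, mul_zero] at hpos
  exact lt_irrefl _ hpos

/-- The sum is, up to sign, the integral over all vertical lines of their contributions, which do
not change sign and do not all vanish. -/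
theorem sum_im_mul_re_ne_zero [NeZero r] (h : IsTightPolygon a s b) :
    ∑ t, (s t).im * (a t - a (t - 1)).re ≠ 0 := by
  obtain ⟨η, hη, hwind⟩ := h.exists_sign_windAngle
  obtain ⟨M, hM⟩ : ∃ M : ℝ, ∀ t, |(a t).re| ≤ M := by
    obtain ⟨t, ht⟩ := Finite.exists_max fun t ↦ |(a t).re|
    exact ⟨_, ht⟩
  set g : ℝ → ℝ := fun x ↦ -(η * ∑ t, crossingSign x (a (t - 1)) (a t) * (s t).im) with hg
  have hint : ∫ x in -M..M, g x = -(η * ∑ t, (s t).im * (a t - a (t - 1)).re) := by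
    rw [intervalIntegral.integral_neg, intervalIntegral.integral_const_mul,
      intervalIntegral.integral_finsetSum]
    · congr 2
      refine Finset.sum_congr rfl fun t _ ↦ ?_
      rw [intervalIntegral.integral_mul_const, (integral_crossingSign (hM _) (hM t)).2,
        Complex.sub_re, mul_comm]
    · exact fun t _ ↦ (integral_crossingSign (hM _) (hM t)).1.mul_const _
  have hgint : IntervalIntegrable g MeasureTheory.volume (-M) M := by
    refine IntervalIntegrable.neg (IntervalIntegrable.const_mul ?_ _)
    have : (fun x ↦ ∑ t, crossingSign x (a (t - 1)) (a t) * (s t).im) =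
        ∑ t, fun x ↦ crossingSign x (a (t - 1)) (a t) * (s t).im := by
      ext x
      simp
    rw [this]
    exact IntervalIntegrable.sum _ fun t _ ↦ (integral_crossingSign (hM _) (hM t)).1.mul_const _
  have hfin : (Set.range fun t ↦ (a t).re).Finite := Set.finite_range _
  have hgpos : ∀ x, x ∉ Set.range (fun t ↦ (a t).re) →
      (∃ t, crossingSign x (a (t - 1)) (a t) ≠ 0) → 0 < g x := fun x hx hc ↦ by
    have := h.sum_crossingSign_mul_im_neg hη hwind (fun t e ↦ hx ⟨t, e⟩) hc
    simp only [hg]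
    linarith
  have hg0 : 0 ≤ᵐ[MeasureTheory.volume] g := by
    filter_upwards [hfin.measure_zero MeasureTheory.volume |> MeasureTheory.compl_mem_ae_iff.mpr]
      with x hx
    by_cases hc : ∃ t, crossingSign x (a (t - 1)) (a t) ≠ 0
    · exact (hgpos x hx hc).le
    · push Not at hc
      simp [hg, hc]
  have hpos : 0 < ∫ x in -M..M, g x := by
    obtain ⟨t, ht⟩ := h.exists_re_ne
    have hb1 := abs_le.mp (hM (t - 1))
    have hb2 := abs_le.mp (hM t)
    rw [intervalIntegral.integral_pos_iff_support_of_nonneg_ae hg0 hgint]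
    have hlt : min (a (t - 1)).re (a t).re < max (a (t - 1)).re (a t).re := min_lt_max.mpr ht
    have hmin : -M ≤ min (a (t - 1)).re (a t).re := le_min hb1.1 hb2.1
    have hmax : max (a (t - 1)).re (a t).re ≤ M := max_le hb1.2 hb2.2
    refine ⟨by linarith, ?_⟩
    have hsub : Set.Ioo (min (a (t - 1)).re (a t).re) (max (a (t - 1)).re (a t).re) \
        Set.range (fun t ↦ (a t).re) ⊆ Function.support g ∩ Set.Ioc (-M) M := by
      rintro x ⟨⟨h1, h2⟩, h3⟩
      refine ⟨(hgpos x h3 ⟨t, ?_⟩).ne', by linarith, by linarith⟩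
      rcases lt_or_gt_of_ne ht with h' | h'
      · rw [min_eq_left h'.le] at h1
        rw [max_eq_right h'.le] at h2
        simp [crossingSign, h2, not_lt.mpr h1.le]
      · rw [min_eq_right h'.le] at h1
        rw [max_eq_left h'.le] at h2
        simp [crossingSign, h2, not_lt.mpr h1.le]
    refine lt_of_lt_of_le ?_ (MeasureTheory.measure_mono hsub)
    rw [MeasureTheory.measure_sdiff_null (hfin.measure_zero _), Real.volume_Ioo]
    simpa using hlt
  rw [hint] at hpos
  intro h0
  rw [h0] at hpos
  simp at hpos

theorem rotate (h : IsTightPolygon a s b) {c : ℂ} (hc : c ≠ 0) :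
    IsTightPolygon (fun t ↦ c * a t) (fun t ↦ c⁻¹ * s t) b := by
  have e : ∀ t k, c⁻¹ * s t * (c * a k) = s t * a k := fun t k ↦ by
    field_simp
  refine ⟨h.three_le, fun t ↦ ?_, fun t k h1 h2 ↦ ?_⟩
  · simp only [e]
    exact h.tie t
  · simp only [e]
    exact h.lt t k h1 h2

/-- There is no tight polygon: since `∑ t, s t * (a t - a (t - 1)) = 0`, the coordinates can be
rotated so that the contributions of the vertical lines cancel. -/
protected theorem false [NeZero r] (h : IsTightPolygon a s b) : False := by
  -- after rotation by `c`, the sum over the vertical lines is half the imaginary part of `c⁻² K`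
  set K : ℂ := ∑ t, s t * (starRingEnd ℂ) (a t - a (t - 1)) with hK
  obtain ⟨c, hc1, hcK⟩ : ∃ c : ℂ, c * (starRingEnd ℂ) c = 1 ∧
      ((starRingEnd ℂ) c * (starRingEnd ℂ) c * K).im = 0 := by
    have hconj : (starRingEnd ℂ) ((K.arg / 2 : ℝ) * Complex.I) = -((K.arg / 2 : ℝ) * Complex.I) := by
      rw [map_mul, Complex.conj_ofReal, Complex.conj_I, mul_neg]
    refine ⟨Complex.exp ((K.arg / 2 : ℝ) * Complex.I), ?_, ?_⟩
    · rw [← Complex.exp_conj, ← Complex.exp_add, hconj, add_neg_cancel, Complex.exp_zero]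
    · rw [← Complex.exp_conj, ← Complex.exp_add, hconj]
      have : Complex.exp (-((K.arg / 2 : ℝ) * Complex.I) + -((K.arg / 2 : ℝ) * Complex.I)) * K =
          ‖K‖ := by
        nth_rw 3 [← Complex.norm_mul_exp_arg_mul_I K]
        rw [mul_left_comm, ← Complex.exp_add]
        push_cast
        ring_nf
        simp
      rw [this, Complex.ofReal_im]
  have hc0 : c ≠ 0 := by
    rintro rfl
    simp at hc1
  have hinv : c⁻¹ = (starRingEnd ℂ) c := inv_eq_of_mul_eq_one_right hc1
  apply (h.rotate hc0).sum_im_mul_re_ne_zero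
  have key : ∀ t, (c⁻¹ * s t).im * (c * a t - c * a (t - 1)).re =
      ((s t * (a t - a (t - 1))).im +
      ((starRingEnd ℂ) c * (starRingEnd ℂ) c * (s t * (starRingEnd ℂ) (a t - a (t - 1)))).im) / 2 := by
    intro t
    have h1 : c * a t - c * a (t - 1) = c * (a t - a (t - 1)) := by ring
    have h2 : s t * (a t - a (t - 1)) = c * (starRingEnd ℂ) c * (s t * (a t - a (t - 1))) := by
      rw [hc1, one_mul]
    rw [hinv, h1, h2]
    simp only [Complex.mul_re, Complex.mul_im, Complex.conj_re, Complex.conj_im]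
    ring
  rw [Finset.sum_congr rfl fun t _ ↦ key t, ← Finset.sum_div, Finset.sum_add_distrib,
    ← Complex.im_sum, ← Complex.im_sum, h.sum_mul_sub, ← Finset.mul_sum, ← hK, hcK]
  simp

end IsTightPolygon

/-! ### Columns and slopes -/

/-- A finite set of nonzero complex numbers has a generic direction: after multiplication by a
suitable number, all real parts are nonzero. -/
theorem exists_forall_re_mul_ne_zero (D : Finset ℂ) :
    ∃ c : ℂ, ∀ d ∈ D, d ≠ 0 → (c * d).re ≠ 0 := by
  obtain ⟨t, ht⟩ := Set.Infinite.exists_notMem_finset Set.infinite_univ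
    (D.image fun d ↦ d.re / d.im)
  refine ⟨1 + t * Complex.I, fun d hd hd0 h0 ↦ ?_⟩
  have hre : d.re = t * d.im := by
    simp at h0
    linarith
  by_cases him : d.im = 0
  · exact hd0 (Complex.ext (by simp [hre, him]) (by simp [him]))
  · exact ht.2 (Finset.mem_image.mpr ⟨d, hd, by rw [hre]; field_simp⟩)

/-- The affine form of the theorem: a nonempty finite set of points on `n` vertical lines (columns)
cannot have the property that, for `n` slopes, all lines of these slopes through points of the set
contain a second point of the set. -/
theorem false_of_card_columns_le_card_slopes (A : Finset (ℂ × ℂ)) (Sl : Finset ℂ)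
    (hA : A.Nonempty) (hcard : (A.image Prod.fst).card ≤ Sl.card)
    (h : ∀ p ∈ A, ∀ σ ∈ Sl, ∃ q ∈ A, q.1 ≠ p.1 ∧ q.2 - p.2 = σ * (q.1 - p.1)) : False := by
  classical
  obtain ⟨c, hc⟩ := exists_forall_re_mul_ne_zero
    (((A ×ˢ A) ×ˢ Sl).image fun x ↦ (x.1.1.2 - x.2 * x.1.1.1) - (x.1.2.2 - x.2 * x.1.2.1))
  -- in the direction `c`, equality of real parts implies equality
  have hgen : ∀ p ∈ A, ∀ q ∈ A, ∀ σ ∈ Sl,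
      (c * (p.2 - σ * p.1)).re = (c * (q.2 - σ * q.1)).re → p.2 - σ * p.1 = q.2 - σ * q.1 := by
    intro p hp q hq σ hσ he
    by_contra hne
    refine hc _ (Finset.mem_image.mpr ⟨((p, q), σ), ?_, rfl⟩) (sub_ne_zero.mpr hne) ?_
    · simp [hp, hq, hσ]
    · rw [mul_sub, Complex.sub_re, he, sub_self]
  set I := A.image Prod.fst with hI
  have hINe : I.Nonempty := hA.image _
  -- the highest points of the columns
  have htop : ∀ i ∈ I, ∃ y, (i, y) ∈ A ∧ ∀ q ∈ A, q.1 = i → (c * q.2).re ≤ (c * y).re := by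
    intro i hi
    obtain ⟨p, hp, rfl⟩ := Finset.mem_image.mp hi
    obtain ⟨m, hm, hmax⟩ := Finset.exists_max_image (A.filter fun q ↦ q.1 = p.1)
      (fun q ↦ (c * q.2).re) ⟨p, by simp [hp]⟩
    rw [Finset.mem_filter] at hm
    refine ⟨m.2, ?_, fun q hq hqi ↦ hmax q (by simp [hq, hqi])⟩
    rw [← hm.2]
    exact hm.1
  choose! y hyA hymax using htop
  -- for each slope, the highest line
  have hline : ∀ σ ∈ Sl, ∃ B, (∀ i ∈ I, (c * (y i - σ * i)).re ≤ (c * B).re) ∧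
      ∃ i ∈ I, y i - σ * i = B := by
    intro σ _
    obtain ⟨i, hi, hmax⟩ := Finset.exists_max_image I (fun i ↦ (c * (y i - σ * i)).re) hINe
    exact ⟨_, hmax, i, hi, rfl⟩
  choose! B hBmax hBex using hline
  have hstrict : ∀ i ∈ I, ∀ σ ∈ Sl, y i - σ * i ≠ B σ →
      (c * (y i - σ * i)).re < (c * B σ).re := by
    intro i hi σ hσ hne
    refine lt_of_le_of_ne (hBmax σ hσ i hi) fun he ↦ hne ?_
    obtain ⟨k, hk, hkB⟩ := hBex σ hσ
    rw [← hkB] at he ⊢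
    exact hgen _ (hyA i hi) _ (hyA k hk) σ hσ he
  have hSl : Sl.Nonempty := Finset.card_pos.mp (lt_of_lt_of_le (Finset.card_pos.mpr hINe) hcard)
  -- the highest line of each slope passes through the highest points of two columns
  obtain ⟨r, hr, i, j, hr2, hi, hj, hiI, hjS, h1, h2, h3⟩ :=
    exists_chordless_bipartite_cycle (fun i σ ↦ y i - σ * i = B σ) I Sl hcard hSl (by
      intro σ hσ
      obtain ⟨i, hi, hiB⟩ := hBex σ hσ
      obtain ⟨q, hq, hqi, hqe⟩ := h _ (hyA i hi) σ hσ
      simp only at hqi hqe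
      have hqI : q.1 ∈ I := Finset.mem_image_of_mem _ hq
      refine ⟨i, hi, q.1, hqI, hqi.symm, hiB, ?_⟩
      by_contra hne
      have h1 := hstrict _ hqI σ hσ hne
      have h2 := hymax _ hqI q hq rfl
      have h3 : q.2 - σ * q.1 = B σ := by linear_combination hqe + hiB
      rw [← h3, mul_sub, mul_sub, Complex.sub_re, Complex.sub_re] at h1
      linarith)
  rcases Nat.lt_or_ge 2 r with hr3 | hr3
  · have htight : IsTightPolygon i (fun t ↦ c * j t) (fun t ↦ c * B (j t)) := by
      refine ⟨hr3, fun t ↦ ?_, fun t k hk1 hk2 ↦ ?_⟩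
      · linear_combination -c * h1 t + c * h2 t
      · have h4 := hstrict (i t) (hiI t) (j k) (hjS k) fun e ↦ by
          rcases h3 t k e with h | h
          · exact hk1 h
          · exact hk2 h
        have e1 : c * j t * i t + c * B (j t) = c * y (i t) := by linear_combination -c * h1 t
        have e2 : c * y (i t) = c * j k * i t + c * (y (i t) - j k * i t) := by ring
        rw [e1, e2, Complex.add_re, Complex.add_re]
        linarith
    exact htight.false
  · obtain rfl : r = 2 := by omega
    have e : (j 0 - j 1) * (i 0 - i 1) = 0 := by
      have a1 := h1 0
      have a2 := h2 0
      have a3 := h1 1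
      have a4 := h2 1
      rw [show (0 : ZMod 2) + 1 = 1 from rfl] at a2
      rw [show (1 : ZMod 2) + 1 = 0 from rfl] at a4
      linear_combination a2 - a1 + a4 - a3
    rcases mul_eq_zero.mp e with e | e
    · exact absurd (hj (sub_eq_zero.mp e)) (by decide)
    · exact absurd (hi (sub_eq_zero.mp e)) (by decide)


/-! ### Existence of ordinary lines -/

namespace SylvesterGallai

theorem IsLine.exists_direction {l : AffineSubspace ℂ (ℂ × ℂ)} (hl : IsLine l) {P : ℂ × ℂ}
    (hP : P ∈ l) : ∃ v : ℂ × ℂ, v ≠ 0 ∧ ∀ q, q ∈ l ↔ ∃ c : ℂ, q - P = c • v := by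
  obtain ⟨v, hv, hspan⟩ := finrank_eq_one_iff'.mp hl.2
  refine ⟨v, fun h ↦ hv (Subtype.ext h), fun q ↦ ?_⟩
  rw [← AffineSubspace.vsub_right_mem_direction_iff_mem hP q]
  constructor
  · intro hq
    obtain ⟨c, hc⟩ := hspan ⟨q -ᵥ P, hq⟩
    exact ⟨c, (congrArg Subtype.val hc).symm⟩
  · rintro ⟨c, hc⟩
    rw [vsub_eq_sub, hc]
    exact l.direction.smul_mem c v.2

theorem isLine_affineSpan_pair {p q : ℂ × ℂ} (h : p ≠ q) :
    IsLine (affineSpan ℂ {p, q}) := by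
  refine ⟨⟨p, left_mem_affineSpan_pair ℂ p q⟩, ?_⟩
  rw [direction_affineSpan, vectorSpan_pair, finrank_span_singleton]
  rw [vsub_eq_sub]
  exact sub_ne_zero.mpr h

/-- In a set without ordinary lines, the line through two points contains a third point. -/
theorem exists_third_point {S : Set (ℂ × ℂ)}
    (hS : ¬ ∃ l : AffineSubspace ℂ (ℂ × ℂ), IsOrdinaryLine S l) {p q : ℂ × ℂ} (hp : p ∈ S)
    (hq : q ∈ S) (hpq : p ≠ q) : ∃ x ∈ S, x ≠ p ∧ x ≠ q ∧ ∃ τ : ℂ, x = p + τ • (q - p) := by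
  by_contra! hcon
  refine hS ⟨affineSpan ℂ {p, q}, isLine_affineSpan_pair hpq, ?_⟩
  rw [← Set.ncard_pair hpq]
  congr 1
  ext x
  constructor
  · rintro ⟨hxS, hx⟩
    obtain ⟨τ, hτ⟩ := mem_affineSpan_pair_iff_exists_lineMap_eq.mp hx
    by_contra hne
    simp only [Set.mem_insert_iff, Set.mem_singleton_iff, not_or] at hne
    refine hcon x hxS hne.1 hne.2 τ ?_
    rw [← hτ, AffineMap.lineMap_apply, vsub_eq_sub, vadd_eq_add, add_comm]
  · rintro (rfl | rfl)
    · exact ⟨hp, left_mem_affineSpan_pair ℂ _ _⟩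
    · exact ⟨hq, right_mem_affineSpan_pair ℂ _ _⟩

/-- The existence of an ordinary line: the projective map `(X, Y) ↦ (Y / X, 1 / X)`, in coordinates with
origin `P` in which the distinguished line is `X = 0`, sends this line to infinity: the other lines
become columns, and its points other than `P` become slopes. -/
theorem exists_isOrdinaryLine {S : Set (ℂ × ℂ)} (hfin : S.Finite) (hncol : ¬ Collinear ℂ S)
    {L : Finset (AffineSubspace ℂ (ℂ × ℂ))} {P : ℂ × ℂ} (hL : IsConcurrentAt L P)
    (hSL : LiesOn S L) {l₀ : AffineSubspace ℂ (ℂ × ℂ)} (hl₀ : l₀ ∈ L)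
    (hcount : (L.card : ℤ) - 2 < (countOff S P l₀ : ℤ)) :
    ∃ l : AffineSubspace ℂ (ℂ × ℂ), IsOrdinaryLine S l := by
  classical
  by_contra hno
  obtain ⟨v, hv0, hv⟩ := (hL l₀ hl₀).1.exists_direction (hL l₀ hl₀).2
  obtain ⟨μ, ν, hμν⟩ : ∃ μ ν : ℂ, μ * v.1 + ν * v.2 = 1 := by
    by_cases h1 : v.1 = 0
    · have h2 : v.2 ≠ 0 := fun h2 ↦ hv0 (Prod.ext h1 h2)
      exact ⟨0, v.2⁻¹, by simp [h2]⟩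
    · exact ⟨v.1⁻¹, 0, by simp [h1]⟩
  set X : ℂ × ℂ → ℂ := fun q ↦ v.1 * (q.2 - P.2) - v.2 * (q.1 - P.1) with hX
  set Y : ℂ × ℂ → ℂ := fun q ↦ μ * (q.1 - P.1) + ν * (q.2 - P.2) with hY
  have hX0 : ∀ q, X q = 0 → q - P = Y q • v := by
    intro q hq
    simp only [hX] at hq
    apply Prod.ext
    · simp only [hY, Prod.fst_sub, Prod.smul_fst, smul_eq_mul]
      linear_combination (-(q.1 - P.1)) * hμν - ν * hq
    · simp only [hY, Prod.snd_sub, Prod.smul_snd, smul_eq_mul]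
      linear_combination (-(q.2 - P.2)) * hμν + μ * hq
  have hmem : ∀ q, q ∈ l₀ ↔ X q = 0 := by
    intro q
    rw [hv]
    constructor
    · rintro ⟨c, hc⟩
      have e1 := congrArg Prod.fst hc
      have e2 := congrArg Prod.snd hc
      simp only [Prod.fst_sub, Prod.snd_sub, Prod.smul_fst, Prod.smul_snd, smul_eq_mul] at e1 e2
      simp only [hX]
      rw [e1, e2]
      ring
    · exact fun hq ↦ ⟨_, hX0 q hq⟩
  set F := hfin.toFinset with hF
  have hFS : ∀ q, q ∈ F ↔ q ∈ S := fun q ↦ hfin.mem_toFinset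
  set A := (F.filter fun q ↦ X q ≠ 0).image fun q ↦ (Y q / X q, 1 / X q) with hAdef
  set Sl := (F.filter fun q ↦ X q = 0 ∧ Y q ≠ 0).image fun q ↦ 1 / Y q with hSldef
  -- the number of slopes is the number of points on the distinguished line
  have hSlcard : Sl.card = countOff S P l₀ := by
    rw [hSldef, Finset.card_image_of_injOn, countOff, ← Set.ncard_coe_finset]
    · congr 1
      ext q
      simp only [Finset.coe_filter, hFS, Set.mem_ofPred_eq, Set.mem_sdiff, Set.mem_inter_iff,
        SetLike.mem_coe, hmem, Set.mem_singleton_iff, and_assoc]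
      refine and_congr_right fun _ ↦ and_congr_right fun hq ↦ not_congr ?_
      constructor
      · intro hYq
        have := hX0 q hq
        rwa [hYq, zero_smul, sub_eq_zero] at this
      · rintro rfl
        simp [hY]
    · intro q hq q' hq' he
      simp only [Finset.coe_filter, Set.mem_ofPred_eq] at hq hq'
      have h1 : Y q = Y q' := by simpa using he
      have h2 := hX0 q hq.2.1
      rw [h1, ← hX0 q' hq'.2.1] at h2
      exact sub_left_injective h2
  -- every other line of the family is a column
  have hcol : ∀ l ∈ L, ∃ φ : ℂ, ∀ q ∈ l, X q ≠ 0 → Y q / X q = φ := by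
    intro l hl
    obtain ⟨w, -, hw⟩ := (hL l hl).1.exists_direction (hL l hl).2
    refine ⟨(μ * w.1 + ν * w.2) / (v.1 * w.2 - v.2 * w.1), fun q hq hXq ↦ ?_⟩
    obtain ⟨c, hc⟩ := (hw q).mp hq
    have e1 := congrArg Prod.fst hc
    have e2 := congrArg Prod.snd hc
    simp only [Prod.fst_sub, Prod.snd_sub, Prod.smul_fst, Prod.smul_snd, smul_eq_mul] at e1 e2
    have eX : X q = c * (v.1 * w.2 - v.2 * w.1) := by
      simp only [hX]
      rw [e1, e2]
      ring
    have eY : Y q = c * (μ * w.1 + ν * w.2) := by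
      simp only [hY]
      rw [e1, e2]
      ring
    rw [eX] at hXq
    rw [eX, eY, mul_div_mul_left _ _ (left_ne_zero_of_mul hXq)]
  choose! φ hφ using hcol
  have hcolcard : (A.image Prod.fst).card ≤ (L.erase l₀).card := by
    refine le_trans (Finset.card_le_card ?_) (Finset.card_image_le (f := φ))
    intro x hx
    simp only [hAdef, Finset.mem_image, Finset.mem_filter, hFS] at hx
    obtain ⟨p, ⟨q, ⟨hqS, hqX⟩, rfl⟩, rfl⟩ := hx
    obtain ⟨l, hl, hql⟩ := hSL q hqS
    refine Finset.mem_image.mpr ⟨l, Finset.mem_erase.mpr ⟨?_, hl⟩, (hφ l hl q hql hqX).symm⟩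
    rintro rfl
    exact hqX ((hmem q).mp hql)
  refine false_of_card_columns_le_card_slopes A Sl ?_ ?_ ?_
  · by_contra hempty
    rw [Finset.not_nonempty_iff_eq_empty, hAdef, Finset.image_eq_empty,
      Finset.filter_eq_empty_iff] at hempty
    refine hncol ((collinear_iff_exists_forall_eq_smul_vadd (k := ℂ) S).mpr ⟨P, v, fun q hq ↦ ?_⟩)
    have := hX0 q (not_not.mp (hempty ((hFS q).mpr hq)))
    exact ⟨Y q, by rw [vadd_eq_add, ← this, sub_add_cancel]⟩
  · have := Finset.card_erase_of_mem hl₀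
    have := Finset.card_pos.mpr ⟨l₀, hl₀⟩
    omega
  · intro p hp σ hσ
    simp only [hAdef, hSldef, Finset.mem_image, Finset.mem_filter, hFS] at hp hσ
    obtain ⟨q, ⟨hqS, hqX⟩, rfl⟩ := hp
    obtain ⟨u, ⟨huS, huX, huY⟩, rfl⟩ := hσ
    have hqu : q ≠ u := fun e ↦ hqX (e ▸ huX)
    obtain ⟨x, hxS, hxq, hxu, τ, hτ⟩ := exists_third_point hno hqS huS hqu
    have hτ0 : τ ≠ 0 := fun h0 ↦ hxq (by rw [hτ, h0, zero_smul, add_zero])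
    have hτ1 : 1 - τ ≠ 0 := fun h0 ↦ hxu (by
      rw [hτ, ← sub_eq_zero.mp h0, one_smul, add_sub_cancel])
    have e1 := congrArg Prod.fst hτ
    have e2 := congrArg Prod.snd hτ
    simp only [Prod.fst_add, Prod.snd_add, Prod.smul_fst, Prod.smul_snd, Prod.fst_sub,
      Prod.snd_sub, smul_eq_mul] at e1 e2
    have eX : X x = (1 - τ) * X q := by
      have : X x = (1 - τ) * X q + τ * X u := by
        simp only [hX]
        rw [e1, e2]
        ring
      rw [this, huX]
      ring
    have eY : Y x = (1 - τ) * Y q + τ * Y u := by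
      simp only [hY]
      rw [e1, e2]
      ring
    have hxX : X x ≠ 0 := by
      rw [eX]
      exact mul_ne_zero hτ1 hqX
    have hdiff : Y x / X x - Y q / X q = τ * Y u / ((1 - τ) * X q) := by
      rw [eX, eY]
      field_simp
      ring
    refine ⟨(Y x / X x, 1 / X x), ?_, ?_, ?_⟩
    · exact Finset.mem_image.mpr ⟨x, by simp [hFS, hxS, hxX], rfl⟩
    · rw [Ne, ← sub_eq_zero]
      change ¬ (Y x / X x - Y q / X q = 0)
      rw [hdiff]
      exact div_ne_zero (mul_ne_zero hτ0 huY) (mul_ne_zero hτ1 hqX)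
    · change 1 / X x - 1 / X q = 1 / Y u * (Y x / X x - Y q / X q)
      rw [hdiff, eX]
      field_simp
      ring

end SylvesterGallai

/-! ### The Fermat configuration -/

namespace SylvesterGallai

theorem exists_eq_smul_of_cross_eq_zero {v w : ℂ × ℂ} (hv : v ≠ 0)
    (h : v.1 * w.2 - v.2 * w.1 = 0) : ∃ c : ℂ, w = c • v := by
  by_cases h1 : v.1 = 0
  · have h2 : v.2 ≠ 0 := fun h2 ↦ hv (Prod.ext h1 h2)
    have h3 : w.1 = 0 := by simpa [h1, h2] using h
    exact ⟨w.2 / v.2, Prod.ext (by simp [h1, h3]) (by simp [h2])⟩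
  · refine ⟨w.1 / v.1, Prod.ext (by simp [h1]) ?_⟩
    simp only [Prod.smul_snd, smul_eq_mul]
    field_simp
    linear_combination h

/-- Twice the signed area of a triangle; it vanishes if and only if the points are collinear. -/
def area (p q x : ℂ × ℂ) : ℂ := (q.1 - p.1) * (x.2 - p.2) - (q.2 - p.2) * (x.1 - p.1)

theorem area_swap_left (p q x : ℂ × ℂ) : area q p x = -area p q x := by
  simp only [area]
  ring

theorem area_swap_right (p q x : ℂ × ℂ) : area p x q = -area p q x := by
  simp only [area]
  ring

/-- The image `[1 : -ω : 0] ↦ (-ω / (1 - 2 ω), 0)` of a point of the Fermat configuration under the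
projective map `[x : y : z] ↦ [y : z : x + 2 y + 4 z]`, which moves the configuration and the
point `[1 : 0 : 0]` into the affine plane. -/
noncomputable def fermatA (ω : ℂ) : ℂ × ℂ := (-ω / (1 - 2 * ω), 0)

/-- The image of `[0 : 1 : -ω]` under the same projective map. -/
noncomputable def fermatB (ω : ℂ) : ℂ × ℂ := (1 / (2 - 4 * ω), -ω / (2 - 4 * ω))

/-- The image of `[-ω : 0 : 1]` under the same projective map. -/
noncomputable def fermatC (ω : ℂ) : ℂ × ℂ := (0, 1 / (4 - ω))

/-- The affine copy of the Fermat configuration. -/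
noncomputable def affineFermat (n : ℕ) : Set (ℂ × ℂ) :=
  fermatA '' {ω | ω ^ n = 1} ∪ fermatB '' {ω | ω ^ n = 1} ∪ fermatC '' {ω | ω ^ n = 1}

section

variable {ω ω' : ℂ}

theorem one_sub_two_mul_ne_zero (h : ‖ω‖ = 1) : 1 - 2 * ω ≠ 0 := by
  intro h0
  have := congrArg norm (sub_eq_zero.mp h0)
  simp [h] at this

theorem two_sub_four_mul_ne_zero (h : ‖ω‖ = 1) : 2 - 4 * ω ≠ 0 := by
  have := mul_ne_zero two_ne_zero (one_sub_two_mul_ne_zero h)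
  intro h0
  exact this (by linear_combination h0)

theorem four_sub_ne_zero (h : ‖ω‖ = 1) : 4 - ω ≠ 0 := by
  intro h0
  have := congrArg norm (sub_eq_zero.mp h0)
  simp [h] at this

theorem ne_zero_of_norm_eq_one (h : ‖ω‖ = 1) : ω ≠ 0 := by
  rintro rfl
  simp at h

theorem fermatA_fst_ne_zero (h : ‖ω‖ = 1) : (fermatA ω).1 ≠ 0 :=
  div_ne_zero (neg_ne_zero.mpr (ne_zero_of_norm_eq_one h)) (one_sub_two_mul_ne_zero h)

theorem fermatB_fst_ne_zero (h : ‖ω‖ = 1) : (fermatB ω).1 ≠ 0 :=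
  div_ne_zero one_ne_zero (two_sub_four_mul_ne_zero h)

theorem fermatB_snd_ne_zero (h : ‖ω‖ = 1) : (fermatB ω).2 ≠ 0 :=
  div_ne_zero (neg_ne_zero.mpr (ne_zero_of_norm_eq_one h)) (two_sub_four_mul_ne_zero h)

theorem fermatC_snd_ne_zero (h : ‖ω‖ = 1) : (fermatC ω).2 ≠ 0 :=
  div_ne_zero one_ne_zero (four_sub_ne_zero h)

theorem fermatA_ne_fermatB (h : ‖ω'‖ = 1) : fermatA ω ≠ fermatB ω' := fun e ↦
  fermatB_snd_ne_zero h (congrArg Prod.snd e).symm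

theorem fermatA_ne_fermatC (h : ‖ω'‖ = 1) : fermatA ω ≠ fermatC ω' := fun e ↦
  fermatC_snd_ne_zero h (congrArg Prod.snd e).symm

theorem fermatB_ne_fermatC (h : ‖ω‖ = 1) : fermatB ω ≠ fermatC ω' := fun e ↦
  fermatB_fst_ne_zero h (congrArg Prod.fst e)

theorem fermatA_inj (h : ‖ω‖ = 1) (h' : ‖ω'‖ = 1) (e : fermatA ω = fermatA ω') : ω = ω' := by
  have e := congrArg Prod.fst e
  simp only [fermatA] at e
  rw [div_eq_div_iff (one_sub_two_mul_ne_zero h) (one_sub_two_mul_ne_zero h')] at e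
  linear_combination -e

theorem fermatB_inj (h : ‖ω‖ = 1) (h' : ‖ω'‖ = 1) (e : fermatB ω = fermatB ω') : ω = ω' := by
  have e := congrArg Prod.fst e
  simp only [fermatB] at e
  rw [div_eq_div_iff (two_sub_four_mul_ne_zero h) (two_sub_four_mul_ne_zero h')] at e
  linear_combination (1 / 4) * e

theorem fermatC_inj (h : ‖ω‖ = 1) (h' : ‖ω'‖ = 1) (e : fermatC ω = fermatC ω') : ω = ω' := by
  have e := congrArg Prod.snd e
  simp only [fermatC] at e
  rw [div_eq_div_iff (four_sub_ne_zero h) (four_sub_ne_zero h')] at e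
  linear_combination e

/-- Points on the three sides of the triangle are collinear if their parameters have product one. -/
theorem area_fermat {ω₁ ω₂ ω₃ : ℂ} (h₁ : ‖ω₁‖ = 1) (h₂ : ‖ω₂‖ = 1) (h₃ : ‖ω₃‖ = 1)
    (h : ω₁ * ω₂ * ω₃ = 1) : area (fermatA ω₁) (fermatB ω₂) (fermatC ω₃) = 0 := by
  have := one_sub_two_mul_ne_zero h₁
  have := two_sub_four_mul_ne_zero h₂
  have := four_sub_ne_zero h₃
  have e : area (fermatA ω₁) (fermatB ω₂) (fermatC ω₃) =
      (1 - ω₁ * ω₂ * ω₃) / ((1 - 2 * ω₁) * (2 - 4 * ω₂) * (4 - ω₃)) := by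
    simp only [area, fermatA, fermatB, fermatC]
    field_simp
    ring
  rw [e, h, sub_self, zero_div]

end

section

variable {n : ℕ}

theorem norm_of_pow_eq_one (hn : 3 ≤ n) {ω : ℂ} (h : ω ^ n = 1) : ‖ω‖ = 1 :=
  Complex.norm_eq_one_of_pow_eq_one h (by omega)

theorem ncard_roots (hn : 3 ≤ n) : {ω : ℂ | ω ^ n = 1}.ncard = n := by
  have h := (Complex.isPrimitiveRoot_exp n (by omega)).card_nthRootsFinset
  rw [← Set.ncard_coe_finset] at h
  refine (congrArg Set.ncard ?_).trans h
  ext ω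
  rw [Finset.mem_coe, Polynomial.mem_nthRootsFinset (by omega)]
  rfl

theorem finite_roots (hn : 3 ≤ n) : {ω : ℂ | ω ^ n = 1}.Finite :=
  Set.finite_of_ncard_pos (by rw [ncard_roots hn]; omega)

theorem exists_third_root (hn : 3 ≤ n) (ω ω' : ℂ) : ∃ ζ : ℂ, ζ ^ n = 1 ∧ ζ ≠ ω ∧ ζ ≠ ω' := by
  by_contra! hcon
  have hsub : {ω : ℂ | ω ^ n = 1} ⊆ {ω, ω'} := fun ζ hζ ↦ by
    by_cases h : ζ = ω
    · exact Or.inl h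
    · exact Or.inr (hcon ζ hζ h)
  have := Set.ncard_le_ncard hsub (Set.toFinite _)
  rw [ncard_roots hn] at this
  have := Set.ncard_insert_le ω {ω'}
  rw [Set.ncard_singleton] at this
  omega

/-- Any two points of the affine Fermat configuration are collinear with a third one. -/
theorem exists_third_affineFermat (hn : 3 ≤ n) {p q : ℂ × ℂ} (hp : p ∈ affineFermat n)
    (hq : q ∈ affineFermat n) : ∃ x ∈ affineFermat n, x ≠ p ∧ x ≠ q ∧ area p q x = 0 := by
  have hN : ∀ {ω : ℂ}, ω ^ n = 1 → ‖ω‖ = 1 := norm_of_pow_eq_one hn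
  have hinv : ∀ {ω ω' : ℂ}, ω ^ n = 1 → ω' ^ n = 1 → ((ω * ω')⁻¹) ^ n = 1 := fun h h' ↦ by
    rw [inv_pow, mul_pow, h, h', one_mul, inv_one]
  have hinv' : ∀ {ω ω' : ℂ}, ω ^ n = 1 → ω' ^ n = 1 → ω * ω' * (ω * ω')⁻¹ = 1 := fun h h' ↦
    mul_inv_cancel₀ (mul_ne_zero (ne_zero_of_norm_eq_one (hN h)) (ne_zero_of_norm_eq_one (hN h')))
  have hA : ∀ {ω : ℂ}, ω ^ n = 1 → fermatA ω ∈ affineFermat n := fun h ↦ Or.inl (Or.inl ⟨_, h, rfl⟩)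
  have hB : ∀ {ω : ℂ}, ω ^ n = 1 → fermatB ω ∈ affineFermat n := fun h ↦ Or.inl (Or.inr ⟨_, h, rfl⟩)
  have hC : ∀ {ω : ℂ}, ω ^ n = 1 → fermatC ω ∈ affineFermat n := fun h ↦ Or.inr ⟨_, h, rfl⟩
  have hAB : ∀ {ω ω' : ℂ}, ω ^ n = 1 → ω' ^ n = 1 → ∃ x ∈ affineFermat n,
      x ≠ fermatA ω ∧ x ≠ fermatB ω' ∧ area (fermatA ω) (fermatB ω') x = 0 := fun {ω ω'} h h' ↦
    ⟨fermatC (ω * ω')⁻¹, hC (hinv h h'), (fermatA_ne_fermatC (hN (hinv h h'))).symm,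
      (fermatB_ne_fermatC (hN h')).symm,
      area_fermat (hN h) (hN h') (hN (hinv h h')) (hinv' h h')⟩
  have hAC : ∀ {ω ω' : ℂ}, ω ^ n = 1 → ω' ^ n = 1 → ∃ x ∈ affineFermat n,
      x ≠ fermatA ω ∧ x ≠ fermatC ω' ∧ area (fermatA ω) (fermatC ω') x = 0 := fun {ω ω'} h h' ↦
    ⟨fermatB (ω * ω')⁻¹, hB (hinv h h'), (fermatA_ne_fermatB (hN (hinv h h'))).symm,
      fermatB_ne_fermatC (hN (hinv h h')), by
      rw [area_swap_right, area_fermat (hN h) (hN (hinv h h')) (hN h')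
        (by linear_combination hinv' h h'), neg_zero]⟩
  have hBC : ∀ {ω ω' : ℂ}, ω ^ n = 1 → ω' ^ n = 1 → ∃ x ∈ affineFermat n,
      x ≠ fermatB ω ∧ x ≠ fermatC ω' ∧ area (fermatB ω) (fermatC ω') x = 0 := fun {ω ω'} h h' ↦
    ⟨fermatA (ω * ω')⁻¹, hA (hinv h h'), fermatA_ne_fermatB (hN h), fermatA_ne_fermatC (hN h'), by
      rw [area_swap_right, area_swap_left, area_fermat (hN (hinv h h')) (hN h) (hN h')
        (by linear_combination hinv' h h'), neg_zero, neg_zero]⟩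
  have hswap : ∀ {p q : ℂ × ℂ}, (∃ x ∈ affineFermat n, x ≠ p ∧ x ≠ q ∧ area p q x = 0) →
      ∃ x ∈ affineFermat n, x ≠ q ∧ x ≠ p ∧ area q p x = 0 := by
    rintro p q ⟨x, hx, h1, h2, h3⟩
    exact ⟨x, hx, h2, h1, by rw [area_swap_left, h3, neg_zero]⟩
  rcases hp with (⟨ω, h, rfl⟩ | ⟨ω, h, rfl⟩) | ⟨ω, h, rfl⟩ <;>
    rcases hq with (⟨ω', h', rfl⟩ | ⟨ω', h', rfl⟩) | ⟨ω', h', rfl⟩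
  · obtain ⟨ζ, hζ, h1, h2⟩ := exists_third_root hn ω ω'
    exact ⟨fermatA ζ, hA hζ, fun e ↦ h1 (fermatA_inj (hN hζ) (hN h) e),
      fun e ↦ h2 (fermatA_inj (hN hζ) (hN h') e), by simp [area, fermatA]⟩
  · exact hAB h h'
  · exact hAC h h'
  · exact hswap (hAB h' h)
  · obtain ⟨ζ, hζ, h1, h2⟩ := exists_third_root hn ω ω'
    refine ⟨fermatB ζ, hB hζ, fun e ↦ h1 (fermatB_inj (hN hζ) (hN h) e),
      fun e ↦ h2 (fermatB_inj (hN hζ) (hN h') e), ?_⟩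
    have := two_sub_four_mul_ne_zero (hN h)
    have := two_sub_four_mul_ne_zero (hN h')
    have := two_sub_four_mul_ne_zero (hN hζ)
    simp only [area, fermatB]
    field_simp
    ring
  · exact hBC h h'
  · exact hswap (hAC h' h)
  · exact hswap (hBC h' h)
  · obtain ⟨ζ, hζ, h1, h2⟩ := exists_third_root hn ω ω'
    exact ⟨fermatC ζ, hC hζ, fun e ↦ h1 (fermatC_inj (hN hζ) (hN h) e),
      fun e ↦ h2 (fermatC_inj (hN hζ) (hN h') e), by simp [area, fermatC]⟩

theorem not_exists_isOrdinaryLine_affineFermat (hn : 3 ≤ n) :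
    ¬ ∃ l : AffineSubspace ℂ (ℂ × ℂ), IsOrdinaryLine (affineFermat n) l := by
  rintro ⟨l, hl, hcard⟩
  obtain ⟨p, q, hpq, he⟩ := Set.ncard_eq_two.mp hcard
  have hp : p ∈ affineFermat n ∩ (l : Set (ℂ × ℂ)) := he ▸ Set.mem_insert _ _
  have hq : q ∈ affineFermat n ∩ (l : Set (ℂ × ℂ)) := he ▸ Set.mem_insert_of_mem _ rfl
  obtain ⟨x, hx, hxp, hxq, harea⟩ := exists_third_affineFermat hn hp.1 hq.1
  obtain ⟨v, -, hv⟩ := hl.exists_direction hp.2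
  obtain ⟨c, hc⟩ := (hv q).mp hq.2
  obtain ⟨d, hd⟩ := exists_eq_smul_of_cross_eq_zero (w := x - p) (sub_ne_zero.mpr hpq.symm) harea
  have hxl : x ∈ l := (hv x).mpr ⟨d * c, by rw [hd, hc, smul_smul]⟩
  have : x ∈ ({p, q} : Set (ℂ × ℂ)) := he ▸ ⟨hx, hxl⟩
  rcases this with h | h
  · exact hxp h
  · exact hxq h

/-- The projective coordinate change `[x : y : z] ↦ [y : z : x + 2 y + 4 z]`. -/
def fermatEquiv : (Fin 3 → ℂ) ≃ₗ[ℂ] (Fin 3 → ℂ) where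
  toFun v := ![v 1, v 2, v 0 + 2 * v 1 + 4 * v 2]
  invFun w := ![w 2 - 2 * w 0 - 4 * w 1, w 0, w 1]
  map_add' v w := by
    ext i
    fin_cases i <;> simp
    ring
  map_smul' c v := by
    ext i
    fin_cases i <;> simp
    ring
  left_inv v := by
    ext i
    fin_cases i <;> simp
    ring
  right_inv v := by
    ext i
    fin_cases i <;> simp
    ring

theorem isFermatConfiguration_affineFermat (hn : 3 ≤ n) :
    IsFermatConfiguration n (affineFermat n) := by
  have hA : ∀ {ω : ℂ}, ω ^ n = 1 → Projectivization.map fermatEquiv.toLinearMap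
      fermatEquiv.injective (Projectivization.mk ℂ ![1, -ω, 0]
        (fun h => one_ne_zero (congrFun h 0))) = toProj (fermatA ω) := by
    intro ω h
    have := one_sub_two_mul_ne_zero (norm_of_pow_eq_one hn h)
    rw [Projectivization.map_mk, toProj, Projectivization.mk_eq_mk_iff']
    refine ⟨1 - 2 * ω, ?_⟩
    ext i
    fin_cases i <;> simp [fermatEquiv, fermatA]
    · field_simp
    · ring
  have hB : ∀ {ω : ℂ}, ω ^ n = 1 → Projectivization.map fermatEquiv.toLinearMap
      fermatEquiv.injective (Projectivization.mk ℂ ![0, 1, -ω]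
        (fun h => one_ne_zero (congrFun h 1))) = toProj (fermatB ω) := by
    intro ω h
    have := two_sub_four_mul_ne_zero (norm_of_pow_eq_one hn h)
    rw [Projectivization.map_mk, toProj, Projectivization.mk_eq_mk_iff']
    refine ⟨2 - 4 * ω, ?_⟩
    ext i
    fin_cases i <;> simp [fermatEquiv, fermatB]
    · field_simp
    · field_simp
    · ring
  have hC : ∀ {ω : ℂ}, ω ^ n = 1 → Projectivization.map fermatEquiv.toLinearMap
      fermatEquiv.injective (Projectivization.mk ℂ ![-ω, 0, 1]
        (fun h => one_ne_zero (congrFun h 2))) = toProj (fermatC ω) := by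
    intro ω h
    have := four_sub_ne_zero (norm_of_pow_eq_one hn h)
    rw [Projectivization.map_mk, toProj, Projectivization.mk_eq_mk_iff']
    refine ⟨4 - ω, ?_⟩
    ext i
    fin_cases i <;> simp [fermatEquiv, fermatC]
    · field_simp
    · ring
  refine ⟨fermatEquiv, Set.Subset.antisymm ?_ ?_⟩
  · rintro _ ⟨p, ⟨ω, hω, rfl | rfl | rfl⟩, rfl⟩
    · exact ⟨_, Or.inl (Or.inl ⟨ω, hω, rfl⟩), (hA hω).symm⟩
    · exact ⟨_, Or.inl (Or.inr ⟨ω, hω, rfl⟩), (hB hω).symm⟩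
    · exact ⟨_, Or.inr ⟨ω, hω, rfl⟩, (hC hω).symm⟩
  · rintro _ ⟨_, (⟨ω, hω, rfl⟩ | ⟨ω, hω, rfl⟩) | ⟨ω, hω, rfl⟩, rfl⟩
    · exact ⟨_, ⟨ω, hω, Or.inl rfl⟩, hA hω⟩
    · exact ⟨_, ⟨ω, hω, Or.inr (Or.inl rfl)⟩, hB hω⟩
    · exact ⟨_, ⟨ω, hω, Or.inr (Or.inr rfl)⟩, hC hω⟩

theorem ncard_image_roots (hn : 3 ≤ n) {f : ℂ → ℂ × ℂ}
    (hf : ∀ {ω ω' : ℂ}, ‖ω‖ = 1 → ‖ω'‖ = 1 → f ω = f ω' → ω = ω') :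
    (f '' {ω | ω ^ n = 1}).ncard = n := by
  have hinj : Set.InjOn f {ω | ω ^ n = 1} := fun ω h ω' h' e ↦
    hf (norm_of_pow_eq_one hn h) (norm_of_pow_eq_one hn h') e
  rw [hinj.ncard_image, ncard_roots hn]

theorem finite_affineFermat (hn : 3 ≤ n) : (affineFermat n).Finite :=
  (((finite_roots hn).image _).union ((finite_roots hn).image _)).union ((finite_roots hn).image _)

theorem ncard_affineFermat (hn : 3 ≤ n) : (affineFermat n).ncard = 3 * n := by
  have hf := finite_roots hn
  rw [affineFermat, Set.ncard_union_eq _ ((hf.image _).union (hf.image _)) (hf.image _),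
    Set.ncard_union_eq _ (hf.image _) (hf.image _), ncard_image_roots hn fermatA_inj,
    ncard_image_roots hn fermatB_inj, ncard_image_roots hn fermatC_inj]
  · ring
  · rw [Set.disjoint_left]
    rintro _ ⟨ω, h, rfl⟩ ⟨ω', h', e⟩
    exact fermatA_ne_fermatB (norm_of_pow_eq_one hn h') e.symm
  · rw [Set.disjoint_left]
    rintro _ (⟨ω, h, rfl⟩ | ⟨ω, h, rfl⟩) ⟨ω', h', e⟩
    · exact fermatA_ne_fermatC (norm_of_pow_eq_one hn h') e.symm
    · exact fermatB_ne_fermatC (norm_of_pow_eq_one hn h) e.symm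

theorem not_collinear_affineFermat (hn : 3 ≤ n) : ¬ Collinear ℂ (affineFermat n) := by
  intro hcol
  obtain ⟨p₀, v, hv⟩ := (collinear_iff_exists_forall_eq_smul_vadd (k := ℂ) _).mp hcol
  have hzero : ∀ p ∈ affineFermat n, ∀ q ∈ affineFermat n, ∀ x ∈ affineFermat n,
      area p q x = 0 := by
    intro p hp q hq x hx
    obtain ⟨α, rfl⟩ := hv p hp
    obtain ⟨β, rfl⟩ := hv q hq
    obtain ⟨γ, rfl⟩ := hv x hx
    simp [area]
    ring
  obtain ⟨ζ, hζ, hζ1, -⟩ := exists_third_root hn 1 1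
  have h := hzero _ (Or.inl (Or.inl ⟨1, one_pow n, rfl⟩)) _ (Or.inl (Or.inl ⟨ζ, hζ, rfl⟩)) _
    (Or.inr ⟨1, one_pow n, rfl⟩)
  have h1 := fermatC_snd_ne_zero (norm_of_pow_eq_one hn (one_pow n))
  have h2 : (fermatA 1).2 = 0 := rfl
  have h3 : (fermatA ζ).2 = 0 := rfl
  rw [area, h2, h3, sub_zero, sub_zero, zero_mul, sub_zero] at h
  rcases mul_eq_zero.mp h with h | h
  · refine hζ1 (fermatA_inj (norm_of_pow_eq_one hn hζ) norm_one ?_)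
    exact Prod.ext (sub_eq_zero.mp h) rfl
  · exact h1 h

/-- The line through the origin with direction `v`. -/
noncomputable def lineThroughZero (v : ℂ × ℂ) : AffineSubspace ℂ (ℂ × ℂ) :=
  AffineSubspace.mk' 0 (Submodule.span ℂ {v})

theorem mem_lineThroughZero {v q : ℂ × ℂ} (hv : v ≠ 0) :
    q ∈ lineThroughZero v ↔ v.1 * q.2 - v.2 * q.1 = 0 := by
  rw [lineThroughZero, AffineSubspace.mem_mk', vsub_eq_sub, sub_zero, Submodule.mem_span_singleton]
  constructor
  · rintro ⟨c, rfl⟩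
    simp
    ring
  · intro h
    obtain ⟨c, hc⟩ := exists_eq_smul_of_cross_eq_zero hv h
    exact ⟨c, hc.symm⟩

theorem isLine_lineThroughZero {v : ℂ × ℂ} (hv : v ≠ 0) : IsLine (lineThroughZero v) := by
  refine ⟨⟨0, (mem_lineThroughZero hv).mpr (by simp)⟩, ?_⟩
  rw [lineThroughZero, AffineSubspace.direction_mk', finrank_span_singleton hv]

/-- The lines through the origin witnessing sharpness: two of them carry the families `fermatA` and
`fermatC`, and each of the others carries one point of the family `fermatB`. -/
theorem exists_lines_affineFermat (hn : 3 ≤ n) :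
    ∃ (L : Finset (AffineSubspace ℂ (ℂ × ℂ))) (P : ℂ × ℂ),
      L.card = n + 2 ∧ IsConcurrentAt L P ∧ LiesOn (affineFermat n) L ∧ P ∉ affineFermat n ∧
      ∃ l₁ ∈ L, ∃ l₂ ∈ L, l₁ ≠ l₂ ∧
        countOff (affineFermat n) P l₁ = n ∧ countOff (affineFermat n) P l₂ = n ∧
        ∀ l ∈ L, l ≠ l₁ → l ≠ l₂ → countOff (affineFermat n) P l = 1 := by
  classical
  have hN : ∀ {ω : ℂ}, ω ^ n = 1 → ‖ω‖ = 1 := norm_of_pow_eq_one hn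
  have hv1 : ((1, 0) : ℂ × ℂ) ≠ 0 := fun h ↦ one_ne_zero (congrArg Prod.fst h)
  have hv2 : ((0, 1) : ℂ × ℂ) ≠ 0 := fun h ↦ one_ne_zero (congrArg Prod.snd h)
  have hv3 : ∀ ω : ℂ, ((1, -ω) : ℂ × ℂ) ≠ 0 := fun ω h ↦ one_ne_zero (congrArg Prod.fst h)
  set l₁ := lineThroughZero (1, 0) with hl₁
  set l₂ := lineThroughZero (0, 1) with hl₂
  set l₃ : ℂ → AffineSubspace ℂ (ℂ × ℂ) := fun ω ↦ lineThroughZero (1, -ω) with hl₃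
  have hm1 : ∀ q, q ∈ l₁ ↔ q.2 = 0 := fun q ↦ by simp [hl₁, mem_lineThroughZero hv1]
  have hm2 : ∀ q, q ∈ l₂ ↔ q.1 = 0 := fun q ↦ by simp [hl₂, mem_lineThroughZero hv2]
  have hm3 : ∀ ω q, q ∈ l₃ ω ↔ q.2 = -ω * q.1 := fun ω q ↦ by
    simp only [hl₃]
    rw [mem_lineThroughZero (hv3 ω)]
    simp only [one_mul]
    exact sub_eq_zero
  have hB3 : ∀ {ω ω' : ℂ}, ‖ω‖ = 1 → (fermatB ω ∈ l₃ ω' ↔ ω = ω') := fun {ω ω'} h ↦ by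
    have := two_sub_four_mul_ne_zero h
    rw [hm3]
    simp only [fermatB]
    rw [mul_one_div, div_left_inj' this, neg_inj]
  have h12 : l₁ ≠ l₂ := fun e ↦ by
    have : ((1, 0) : ℂ × ℂ) ∈ l₂ := e ▸ (hm1 _).mpr rfl
    exact one_ne_zero ((hm2 _).mp this)
  have h13 : ∀ ω, ω ^ n = 1 → l₁ ≠ l₃ ω := fun ω hω e ↦ by
    have : fermatB ω ∈ l₁ := e ▸ (hB3 (hN hω)).mpr rfl
    exact fermatB_snd_ne_zero (hN hω) ((hm1 _).mp this)
  have h23 : ∀ ω, ω ^ n = 1 → l₂ ≠ l₃ ω := fun ω hω e ↦ by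
    have : fermatB ω ∈ l₂ := e ▸ (hB3 (hN hω)).mpr rfl
    exact fermatB_fst_ne_zero (hN hω) ((hm2 _).mp this)
  set F := (finite_roots hn).toFinset with hF
  have hFmem : ∀ ω, ω ∈ F ↔ ω ^ n = 1 := fun ω ↦ (finite_roots hn).mem_toFinset
  have hFcard : F.card = n := by
    rw [hF, ← Set.ncard_eq_toFinset_card _ (finite_roots hn), ncard_roots hn]
  have hzero : (0 : ℂ × ℂ) ∉ affineFermat n := by
    rintro ((⟨ω, h, e⟩ | ⟨ω, h, e⟩) | ⟨ω, h, e⟩)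
    · exact fermatA_fst_ne_zero (hN h) (congrArg Prod.fst e)
    · exact fermatB_fst_ne_zero (hN h) (congrArg Prod.fst e)
    · exact fermatC_snd_ne_zero (hN h) (congrArg Prod.snd e)
  have hoff : ∀ l, countOff (affineFermat n) 0 l = (affineFermat n ∩ (l : Set (ℂ × ℂ))).ncard := by
    intro l
    rw [countOff, Set.sdiff_singleton_eq_self fun h ↦ hzero h.1]
  refine ⟨insert l₁ (insert l₂ (F.image l₃)), 0, ?_, ?_, ?_, hzero, l₁, by simp, l₂, by simp, h12,
    ?_, ?_, ?_⟩
  · rw [Finset.card_insert_of_notMem, Finset.card_insert_of_notMem, Finset.card_image_of_injOn,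
      hFcard]
    · intro ω hω ω' hω' e
      have hω := (hFmem ω).mp hω
      have h := (hB3 (hN hω) (ω' := ω)).mpr rfl
      have e : l₃ ω = l₃ ω' := e
      rw [e, hB3 (hN hω)] at h
      exact h
    · intro h
      obtain ⟨ω, hω, e⟩ := Finset.mem_image.mp h
      exact h23 ω ((hFmem ω).mp hω) e.symm
    · intro h
      rcases Finset.mem_insert.mp h with h | h
      · exact h12 h
      · obtain ⟨ω, hω, e⟩ := Finset.mem_image.mp h
        exact h13 ω ((hFmem ω).mp hω) e.symm
  · intro l hl
    simp only [Finset.mem_insert, Finset.mem_image] at hl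
    rcases hl with rfl | rfl | ⟨ω, hω, rfl⟩
    · exact ⟨isLine_lineThroughZero hv1, (hm1 _).mpr rfl⟩
    · exact ⟨isLine_lineThroughZero hv2, (hm2 _).mpr rfl⟩
    · exact ⟨isLine_lineThroughZero (hv3 ω), (hm3 _ _).mpr (by simp)⟩
  · rintro _ ((⟨ω, h, rfl⟩ | ⟨ω, h, rfl⟩) | ⟨ω, h, rfl⟩)
    · exact ⟨l₁, by simp, (hm1 _).mpr rfl⟩
    · refine ⟨l₃ ω, ?_, (hB3 (hN h)).mpr rfl⟩
      simp only [Finset.mem_insert, Finset.mem_image]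
      exact Or.inr (Or.inr ⟨ω, (hFmem ω).mpr h, rfl⟩)
    · exact ⟨l₂, by simp, (hm2 _).mpr rfl⟩
  · rw [hoff]
    refine (congrArg Set.ncard ?_).trans (ncard_image_roots hn fermatA_inj)
    ext q
    rw [Set.mem_inter_iff, SetLike.mem_coe, hm1]
    constructor
    · rintro ⟨(h | ⟨ω, h, rfl⟩) | ⟨ω, h, rfl⟩, hq⟩
      · exact h
      · exact absurd hq (fermatB_snd_ne_zero (hN h))
      · exact absurd hq (fermatC_snd_ne_zero (hN h))
    · rintro ⟨ω, h, rfl⟩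
      exact ⟨Or.inl (Or.inl ⟨ω, h, rfl⟩), rfl⟩
  · rw [hoff]
    refine (congrArg Set.ncard ?_).trans (ncard_image_roots hn fermatC_inj)
    ext q
    rw [Set.mem_inter_iff, SetLike.mem_coe, hm2]
    constructor
    · rintro ⟨(⟨ω, h, rfl⟩ | ⟨ω, h, rfl⟩) | h, hq⟩
      · exact absurd hq (fermatA_fst_ne_zero (hN h))
      · exact absurd hq (fermatB_fst_ne_zero (hN h))
      · exact h
    · rintro ⟨ω, h, rfl⟩
      exact ⟨Or.inr ⟨ω, h, rfl⟩, rfl⟩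
  · intro l hl hl1 hl2
    simp only [Finset.mem_insert, Finset.mem_image, hl1, hl2, false_or] at hl
    obtain ⟨ω, hω, rfl⟩ := hl
    have hω := (hFmem ω).mp hω
    rw [hoff, ← Set.ncard_singleton (fermatB ω)]
    congr 1
    ext q
    rw [Set.mem_inter_iff, SetLike.mem_coe, Set.mem_singleton_iff]
    constructor
    · rintro ⟨(⟨ω', h, rfl⟩ | ⟨ω', h, rfl⟩) | ⟨ω', h, rfl⟩, hq⟩
      · rw [hm3] at hq
        exact absurd hq.symm (mul_ne_zero (neg_ne_zero.mpr (ne_zero_of_norm_eq_one (hN hω)))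
          (fermatA_fst_ne_zero (hN h)))
      · rw [(hB3 (hN h)).mp hq]
      · rw [hm3] at hq
        refine absurd hq ?_
        have : (fermatC ω').1 = 0 := rfl
        rw [this, mul_zero]
        exact fermatC_snd_ne_zero (hN h)
    · rintro rfl
      exact ⟨Or.inl (Or.inr ⟨ω, hω, rfl⟩), (hB3 (hN hω)).mpr rfl⟩

end

end SylvesterGallai

theorem theorem2 :
    (∀ (S : Set (ℂ × ℂ)), S.Finite → ¬ Collinear ℂ S →
      ∀ (m : ℕ) (L : Finset (AffineSubspace ℂ (ℂ × ℂ))) (P : ℂ × ℂ),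
        L.card = m → SylvesterGallai.IsConcurrentAt L P → SylvesterGallai.LiesOn S L →
        (∃ l ∈ L, (m : ℤ) - 2 < (SylvesterGallai.countOff S P l : ℤ)) →
        ∃ l : AffineSubspace ℂ (ℂ × ℂ), SylvesterGallai.IsOrdinaryLine S l) ∧
    (∀ n : ℕ, 3 ≤ n → ∃ S : Set (ℂ × ℂ),
      SylvesterGallai.IsFermatConfiguration n S ∧ S.Finite ∧ S.ncard = 3 * n ∧
      ¬ Collinear ℂ S ∧
      (¬ ∃ l : AffineSubspace ℂ (ℂ × ℂ), SylvesterGallai.IsOrdinaryLine S l) ∧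
      ∃ (L : Finset (AffineSubspace ℂ (ℂ × ℂ))) (P : ℂ × ℂ),
        L.card = n + 2 ∧ SylvesterGallai.IsConcurrentAt L P ∧ SylvesterGallai.LiesOn S L ∧
        P ∉ S ∧
        ∃ l₁ ∈ L, ∃ l₂ ∈ L, l₁ ≠ l₂ ∧
          SylvesterGallai.countOff S P l₁ = n ∧ SylvesterGallai.countOff S P l₂ = n ∧
          ∀ l ∈ L, l ≠ l₁ → l ≠ l₂ → SylvesterGallai.countOff S P l = 1) := by
  refine ⟨?_, fun n hn ↦ ?_⟩
  · rintro S hfin hncol m L P rfl hL hSL ⟨l₀, hl₀, hcount⟩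
    exact SylvesterGallai.exists_isOrdinaryLine hfin hncol hL hSL hl₀ hcount
  · exact ⟨SylvesterGallai.affineFermat n, SylvesterGallai.isFermatConfiguration_affineFermat hn,
      SylvesterGallai.finite_affineFermat hn, SylvesterGallai.ncard_affineFermat hn,
      SylvesterGallai.not_collinear_affineFermat hn,
      SylvesterGallai.not_exists_isOrdinaryLine_affineFermat hn,
      SylvesterGallai.exists_lines_affineFermat hn⟩
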